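/- Let $\mathbb K$ be a field of positive characteristic and $n\ge 1$. Let $\mathscr V$ be the category of finite-dimensional $\mathbb K$-vector spaces and ${}_{\mathfrak S_n}\mathscr V$ that of finite-dimensional representations of the symmetric group $\mathfrak S_n$ over $\mathbb K$; write $M^\vee$ for the dual (contragredient) representation. Let $\mathscr A_n$ be the category of $\mathbb K$-linear functors ${}_{\mathfrak S_n}\mathscr V\to\mathscr V$. For $M$ in ${}_{\mathfrak S_n}\mathscr V$ put $\mathbf h_M=\mathrm{Hom}_{\mathfrak S_n}(M,-)$ and $\mathbf t_M=M\otimes_{\mathfrak S_n}(-)=(M\otimes -)_{\mathfrak S_n}$. Let $\mathscr C_n\subset\mathscr A_n$ be the full subcategory of coherent functors, i.e. of the $\mathbf f$ that admit an exact sequence $\mathbf h_N\to\mathbf h_M\to\mathbf f\to0$. Let $\Gamma^n\mathscr V$ be the category with the objects of $\mathscr V$ and with $\mathrm{Hom}_{\Gamma^n\mathscr V}(V,W)=\Gamma^n(\mathrm{Hom}(V,W))=(\mathrm{Hom}(V,W)^{\otimes n})^{\mathfrak S_n}$, composed factor by factor, and let $\mathscr P_n$ be the category of $\mathbb K$-linear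 functors $\Gamma^n\mathscr V\to\mathscr V$ (homogeneous strict polynomial functors of degree $n$). Let $T^n\in\mathscr P_n$ be $V\mapsto V^{\otimes n}$. Consider the functors - $t^*:\mathscr C_n\to{}_{\mathfrak S_n}\mathscr V$, $t^*(\mathbf f)=\mathbf f(\mathbb K[\mathfrak S_n])$, where $g$ acts through the endomorphism $x\mapsto xg^{-1}$ of $\mathbb K[\mathfrak S_n]$; $t_*(M)=\mathbf h_{M^\vee}$; $t_!(M)=\mathbf t_M$; - $c^*:\mathscr P_n\to{}_{\mathfrak S_n}\mathscr V$, $c^*(F)=\mathrm{Hom}_{\mathscr P_n}(T^n,F)$, where $g$ acts by composition with the permutation $g^{-1}$ of the factors of $T^n$; $c_*(M)(V)=(M\otimes V^{\otimes n})^{\mathfrak S_n}$; $c_!(M)(V)=(M\otimes V^{\otimes n})_{\mathfrak S_n}$; - $j^*:\mathscr C_n\to\mathscr P_n$, $j^*(\mathbf f)(V)=\mathbf f(V^{\otimes n})$; and, for $F$ in $\mathscr P_n$ and $M$ in ${}_{\mathfrak S_n}\mathscr V$, $j_*(F)(M)=\mathrm{Hom}_{\mathscr P_n}(j^*(\mathbf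 h_M),F)$ and $j_!(F)(M)=\mathrm{Hom}_{\mathscr P_n}(F,(-)^{\otimes n}\otimes_{\mathfrak S_n}M^\vee)^\vee$. Let $\mathscr C_n^0\subset\mathscr C_n$ and $\mathscr P_n^0\subset\mathscr P_n$ be the full subcategories of the objects killed by $t^*$ and by $c^*$ respectively, with inclusions $r_*$ and $d_*$, and let $i_*:\mathscr C_n^{\mathsf Y}\subset\mathscr C_n$ be the full subcategory of the $\mathbf f$ such that $\mathbf f(\mathbb K[\mathfrak S_n/\mathfrak S_\lambda])=0$ for every partition $\lambda$ of $n$, where $\mathfrak S_\lambda$ is the Young subgroup of $\lambda$. Then the functors $t_!$, $j_*$ and $j_!$ take their values in $\mathscr C_n$ (as $t_*$ does), and the following diagrams of categories and functors commute. 1. $j_*\circ c_*\cong t_*$ as functors ${}_{\mathfrak S_n}\mathscr V\to\mathscr C_n$. 2. $c^*\circ j^*\cong t^*$ as functors $\mathscr C_n\to{}_{\mathfrak S_n}\mathscr V$. Moreover $i_*$ factors as $\mathscr C_n^{\mathsf Y}\to\mathscr C_n^0\xrightarrow{r_*}\mathscr C_n$ (that is, $\mathscr C_n^{\mathsf Y}\subset\mathscr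 C_n^0$), and $j^*$ restricts to a functor $j_0:\mathscr C_n^0\to\mathscr P_n^0$ with $d_*\circ j_0=j^*\circ r_*$. 3. $j_!\circ c_!\cong t_!$ as functors ${}_{\mathfrak S_n}\mathscr V\to\mathscr C_n$. Here $\cong$ denotes natural isomorphism. -/

import Mathlib

universe u

noncomputable section

namespace PolyRec

open CategoryTheory Limits Opposite MonoidalCategory
open scoped TensorProduct

/-! ### Linear functors -/

section LinearFunctors

variable (K : Type u) [Field K]

/-- The `K`-linear functors from `C` to finite dimensional vector spaces. -/
def isLinearFunctor (C : Type*) [Category* C] [Preadditive C] [Linear K C] :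
    ObjectProperty (C ⥤ FGModuleCat.{u} K) :=
  fun F => F.Additive ∧ F.Linear K

/-- The category of `K`-linear functors from `C` to finite dimensional vector spaces, with all
natural transformations as morphisms. -/
abbrev LinFun (C : Type*) [Category* C] [Preadditive C] [Linear K C] :=
  (isLinearFunctor K C).FullSubcategory

variable {C : Type*} [Category* C] [Preadditive C] [Linear K C]
  {D : Type*} [Category* D] [Preadditive D] [Linear K D]

instance (F : LinFun K C) : F.obj.Additive := F.property.1

instance (F : LinFun K C) : F.obj.Linear K := F.property.2

/-- Precomposition with a linear functor. -/
def precomp (i : C ⥤ D) [i.Additive] [i.Linear K] : LinFun K D ⥤ LinFun K C where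
  obj F := ⟨i ⋙ F.obj, inferInstance, inferInstance⟩
  map α := ObjectProperty.homMk (Functor.whiskerLeft i α.hom)

instance (i : C ⥤ D) [i.Additive] [i.Linear K] : (precomp K i).Additive where
  map_add := rfl

instance (i : C ⥤ D) [i.Additive] [i.Linear K] : (precomp K i).Linear K where
  map_smul _ _ := rfl

end LinearFunctors

section Hom

variable (K : Type u) [Field K]

/-- Duality of finite dimensional vector spaces. -/
def dualV : (FGModuleCat.{u} K)ᵒᵖ ⥤ FGModuleCat.{u} K where
  obj V := FGModuleCat.of K (Module.Dual K V.unop)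
  map f := FGModuleCat.ofHom (f.unop.hom.hom.dualMap)

theorem dualV_map_add {V W : FGModuleCat.{u} K} (f g : V ⟶ W) :
    (dualV K).map (f + g).op = (dualV K).map f.op + (dualV K).map g.op :=
  FGModuleCat.hom_ext (LinearMap.ext fun (φ : Module.Dual K W) => LinearMap.ext fun x =>
    map_add φ (f.hom.hom x) (g.hom.hom x))

theorem dualV_map_smul {V W : FGModuleCat.{u} K} (r : K) (f : V ⟶ W) :
    (dualV K).map (r • f).op = r • (dualV K).map f.op :=
  FGModuleCat.hom_ext (LinearMap.ext fun (φ : Module.Dual K W) => LinearMap.ext fun x =>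
    map_smul φ r (f.hom.hom x))

theorem dualV_map_comp {U V W : FGModuleCat.{u} K} (f : U ⟶ V) (g : V ⟶ W) :
    (dualV K).map (f ≫ g).op = (dualV K).map g.op ≫ (dualV K).map f.op := rfl

/-- The contravariant functor `Q ↦ Q(-)^∨`, from contravariant functors to functors. -/
def dualFun (C : Type*) [Category* C] :
    (Cᵒᵖ ⥤ FGModuleCat.{u} K)ᵒᵖ ⥤ (C ⥤ FGModuleCat.{u} K) where
  obj Q := Q.unop.rightOp ⋙ dualV K
  map α := Functor.whiskerRight (NatTrans.rightOp α.unop) (dualV K)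

variable (C : Type*) [Category.{u} C] [Preadditive C] [Linear K C]
  [∀ X Y : C, Module.Finite K (X ⟶ Y)]

/-- The contravariant functor `M ↦ Hom(M, -)`. -/
def hFun : Cᵒᵖ ⥤ LinFun K C where
  obj M :=
    ⟨{ obj := fun X => FGModuleCat.of K (M.unop ⟶ X)
       map := fun f => FGModuleCat.ofHom (Linear.rightComp K M.unop f)
       map_id := fun _ => FGModuleCat.hom_ext (LinearMap.ext fun x => Category.comp_id x)
       map_comp := fun f g =>
        FGModuleCat.hom_ext (LinearMap.ext fun x => (Category.assoc x f g).symm) },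
      { map_add := fun {_ _ _ _} =>
          FGModuleCat.hom_ext (LinearMap.ext fun _ => Preadditive.comp_add _ _ _ _ _ _) },
      { map_smul := fun _ _ =>
          FGModuleCat.hom_ext (LinearMap.ext fun _ => Linear.comp_smul _ _ _ _ _ _) }⟩
  map a := ObjectProperty.homMk
    { app := fun X => FGModuleCat.ofHom (Linear.leftComp K X a.unop)
      naturality := fun _ _ _ =>
        FGModuleCat.hom_ext (LinearMap.ext fun _ => (Category.assoc _ _ _).symm) }
  map_id _ := ObjectProperty.hom_ext _ (NatTrans.ext (funext fun _ =>
    FGModuleCat.hom_ext (LinearMap.ext fun x => Category.id_comp x)))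
  map_comp _ _ := ObjectProperty.hom_ext _ (NatTrans.ext (funext fun _ =>
    FGModuleCat.hom_ext (LinearMap.ext fun x => Category.assoc _ _ x)))

theorem hFun_map_add {X Y : C} (f g : X ⟶ Y) :
    (hFun K C).map (f + g).op = (hFun K C).map f.op + (hFun K C).map g.op :=
  ObjectProperty.hom_ext _ (NatTrans.ext (funext fun _ => FGModuleCat.hom_ext
    (LinearMap.ext fun _ => Preadditive.add_comp _ _ _ _ _ _)))

theorem hFun_map_smul {X Y : C} (r : K) (f : X ⟶ Y) :
    (hFun K C).map (r • f).op = r • (hFun K C).map f.op :=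
  ObjectProperty.hom_ext _ (NatTrans.ext (funext fun _ => FGModuleCat.hom_ext
    (LinearMap.ext fun _ => Linear.smul_comp _ _ _ _ _ _)))

end Hom

section Hom

variable (K : Type u) [Field K]

variable (C : Type*) [Category* C] [Preadditive C] [Linear K C]
  [∀ X Y : C, Small.{u} (X ⟶ Y)]

instance [∀ X Y : C, Module.Finite K (X ⟶ Y)] (X Y : C) : Module.Finite K (Shrink.{u} (X ⟶ Y)) :=
  Module.Finite.equiv (Shrink.linearEquiv K (X ⟶ Y)).symm

variable {C} in
/-- Transport of a linear map between spaces of morphisms to their small models. -/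
def shrinkMap {X Y X' Y' : C} (φ : (X ⟶ Y) →ₗ[K] (X' ⟶ Y')) :
    Shrink.{u} (X ⟶ Y) →ₗ[K] Shrink.{u} (X' ⟶ Y') :=
  (Shrink.linearEquiv K _).symm.toLinearMap ∘ₗ φ ∘ₗ (Shrink.linearEquiv K _).toLinearMap

variable {C} in
theorem shrinkMap_id {X Y : C} (φ : (X ⟶ Y) →ₗ[K] (X ⟶ Y)) (h : ∀ x, φ x = x) :
    shrinkMap K φ = LinearMap.id := by
  ext x; simp [shrinkMap, h]

variable {C} in
theorem shrinkMap_comp {X Y X' Y' X'' Y'' : C} (φ : (X ⟶ Y) →ₗ[K] (X' ⟶ Y'))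
    (ψ : (X' ⟶ Y') →ₗ[K] (X'' ⟶ Y'')) (χ : (X ⟶ Y) →ₗ[K] (X'' ⟶ Y''))
    (h : ∀ x, χ x = ψ (φ x)) : shrinkMap K χ = shrinkMap K ψ ∘ₗ shrinkMap K φ := by
  ext x; simp [shrinkMap, h]

variable {C} in
theorem shrinkMap_add {X Y X' Y' : C} (φ ψ χ : (X ⟶ Y) →ₗ[K] (X' ⟶ Y'))
    (h : ∀ x, χ x = φ x + ψ x) : shrinkMap K χ = shrinkMap K φ + shrinkMap K ψ := by
  ext x; simp [shrinkMap, h]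

variable {C} in
theorem shrinkMap_smul {X Y X' Y' : C} (r : K) (φ χ : (X ⟶ Y) →ₗ[K] (X' ⟶ Y'))
    (h : ∀ x, χ x = r • φ x) : shrinkMap K χ = r • shrinkMap K φ := by
  ext x; simp [shrinkMap, h]

variable [∀ X Y : C, Module.Finite K (X ⟶ Y)]

/-- The bifunctor `(X, Y) ↦ Hom(X, Y)` with values in finite dimensional vector spaces
(each space of morphisms being replaced by an isomorphic one in the universe of `K`). -/
def homFun : Cᵒᵖ ⥤ C ⥤ FGModuleCat.{u} K where
  obj X :=
    { obj := fun Y => FGModuleCat.of K (Shrink.{u} (X.unop ⟶ Y))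
      map := fun f => FGModuleCat.ofHom (shrinkMap K (Linear.rightComp K X.unop f))
      map_id := fun _ => FGModuleCat.hom_ext (shrinkMap_id K _ fun x => Category.comp_id x)
      map_comp := fun f g => FGModuleCat.hom_ext
        (shrinkMap_comp K _ _ _ fun x => (Category.assoc x f g).symm) }
  map a :=
    { app := fun Y => FGModuleCat.ofHom (shrinkMap K (Linear.leftComp K Y a.unop))
      naturality := fun _ _ f => FGModuleCat.hom_ext
        ((shrinkMap_comp K _ _ (Linear.leftComp K _ a.unop ∘ₗ Linear.rightComp K _ f)
          fun _ => rfl).symm.trans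
          (shrinkMap_comp K _ _ _ fun x => (Category.assoc a.unop x f).symm)) }
  map_id _ := NatTrans.ext (funext fun _ =>
    FGModuleCat.hom_ext (shrinkMap_id K _ fun x => Category.id_comp x))
  map_comp f g := NatTrans.ext (funext fun _ => FGModuleCat.hom_ext
    (shrinkMap_comp K _ _ _ fun x => Category.assoc g.unop f.unop x))

instance (X : Cᵒᵖ) : ((homFun K C).obj X).Additive where
  map_add := FGModuleCat.hom_ext
    (shrinkMap_add K _ _ _ fun _ => Preadditive.comp_add _ _ _ _ _ _)

instance (X : Cᵒᵖ) : ((homFun K C).obj X).Linear K where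
  map_smul _ _ := FGModuleCat.hom_ext
    (shrinkMap_smul K _ _ _ fun _ => Linear.comp_smul _ _ _ _ _ _)

theorem homFun_map_add_app {X Y : C} (f g : X ⟶ Y) (Z : C) :
    ((homFun K C).map (f + g).op).app Z =
      ((homFun K C).map f.op).app Z + ((homFun K C).map g.op).app Z :=
  FGModuleCat.hom_ext (shrinkMap_add K _ _ _ fun _ => Preadditive.add_comp _ _ _ _ _ _)

theorem homFun_map_smul_app {X Y : C} (r : K) (f : X ⟶ Y) (Z : C) :
    ((homFun K C).map (r • f).op).app Z = r • ((homFun K C).map f.op).app Z :=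
  FGModuleCat.hom_ext (shrinkMap_smul K _ _ _ fun _ => Linear.smul_comp _ _ _ _ _ _)

end Hom

/-! ### Divided powers -/
section Gamma
variable (K : Type u) [Field K] (n : ℕ)

/-- The symmetric group on `n` letters. -/
abbrev SymGrp := Equiv.Perm (Fin n)

/-- The action of the symmetric group on `V^{⊗ n}` by permuting the factors. -/
def tensorPerm (V : Type*) [AddCommGroup V] [Module K V] :
    Representation K (SymGrp n) (⨂[K] _ : Fin n, V) where
  toFun σ := (PiTensorProduct.reindex K (fun _ => V) σ).toLinearMap
  map_one' := by
    ext x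
    simp only [LinearMap.compMultilinearMap_apply, LinearEquiv.coe_coe]
    erw [PiTensorProduct.reindex_tprod]
    rfl
  map_mul' σ τ := by
    ext x
    simp only [LinearMap.compMultilinearMap_apply, LinearEquiv.coe_coe, Module.End.mul_apply]
    erw [PiTensorProduct.reindex_tprod, PiTensorProduct.reindex_tprod,
      PiTensorProduct.reindex_tprod]
    rfl

theorem tensorPerm_tprod {V : Type*} [AddCommGroup V] [Module K V] (σ : SymGrp n) (x : Fin n → V) :
    tensorPerm K n V σ (PiTensorProduct.tprod K x) =
      PiTensorProduct.tprod K (fun i => x (σ.symm i)) :=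
  PiTensorProduct.reindex_tprod σ x

/-- The `n`-th divided power `Γⁿ(V) = (V^{⊗ n})^{𝔖ₙ}`. -/
abbrev divPow (V : Type*) [AddCommGroup V] [Module K V] : Submodule K (⨂[K] _ : Fin n, V) :=
  (tensorPerm K n V).invariants

theorem mem_divPow {V : Type*} [AddCommGroup V] [Module K V] (x : ⨂[K] _ : Fin n, V) :
    x ∈ divPow K n V ↔ ∀ σ : SymGrp n, tensorPerm K n V σ x = x := Iff.rfl

section Composition

variable {U V W X : Type*} [AddCommGroup U] [Module K U] [AddCommGroup V] [Module K V]
  [AddCommGroup W] [Module K W] [AddCommGroup X] [Module K X]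

/-- The bilinear map `Hom(V, W)^{⊗ n} × Hom(U, V)^{⊗ n} → Hom(U, W)^{⊗ n}` which composes
factor by factor. -/
def tensorComp : (⨂[K] _ : Fin n, V →ₗ[K] W) →ₗ[K] (⨂[K] _ : Fin n, U →ₗ[K] V) →ₗ[K]
    (⨂[K] _ : Fin n, U →ₗ[K] W) :=
  PiTensorProduct.map₂ (fun _ => LinearMap.llcomp K U V W)

theorem tensorComp_tprod (g : Fin n → V →ₗ[K] W) (f : Fin n → U →ₗ[K] V) :
    tensorComp K n (PiTensorProduct.tprod K g) (PiTensorProduct.tprod K f) =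
      PiTensorProduct.tprod K (fun i => g i ∘ₗ f i) :=
  PiTensorProduct.map₂_tprod_tprod _ _ _

theorem tensor_induction {V : Type*} [AddCommGroup V] [Module K V]
    {P : (⨂[K] _ : Fin n, V) → Prop} (h : ∀ v, P (PiTensorProduct.tprod K v))
    (hs : ∀ (r : K) x, P x → P (r • x)) (ha : ∀ x y, P x → P y → P (x + y)) (x) : P x :=
  PiTensorProduct.induction_on x (fun r v => hs r _ (h v)) ha

theorem tensorPerm_tensorComp (σ : SymGrp n) (g : ⨂[K] _ : Fin n, V →ₗ[K] W)
    (f : ⨂[K] _ : Fin n, U →ₗ[K] V) :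
    tensorPerm K n _ σ (tensorComp K n g f) =
      tensorComp K n (tensorPerm K n _ σ g) (tensorPerm K n _ σ f) := by
  induction g using tensor_induction with
  | h g =>
    induction f using tensor_induction with
    | h f => simp only [tensorComp_tprod, tensorPerm_tprod]
    | hs r x hx => simp only [map_smul, hx]
    | ha x y hx hy => simp only [map_add, hx, hy]
  | hs r x hx => simp only [map_smul, LinearMap.smul_apply, hx]
  | ha x y hx hy => simp only [map_add, LinearMap.add_apply, hx, hy]

theorem tensorComp_assoc (h : ⨂[K] _ : Fin n, W →ₗ[K] X) (g : ⨂[K] _ : Fin n, V →ₗ[K] W)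
    (f : ⨂[K] _ : Fin n, U →ₗ[K] V) :
    tensorComp K n h (tensorComp K n g f) = tensorComp K n (tensorComp K n h g) f := by
  induction h using tensor_induction with
  | h h =>
    induction g using tensor_induction with
    | h g =>
      induction f using tensor_induction with
      | h f => simp only [tensorComp_tprod, LinearMap.comp_assoc]
      | hs r x hx => simp only [map_smul, hx]
      | ha x y hx hy => simp only [map_add, hx, hy]
    | hs r x hx => simp only [map_smul, LinearMap.smul_apply, hx]
    | ha x y hx hy => simp only [map_add, LinearMap.add_apply, hx, hy]
  | hs r x hx => simp only [map_smul, LinearMap.smul_apply, hx]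
  | ha x y hx hy => simp only [map_add, LinearMap.add_apply, hx, hy]

theorem tensorComp_id (f : ⨂[K] _ : Fin n, U →ₗ[K] V) :
    tensorComp K n f (PiTensorProduct.tprod K fun _ => LinearMap.id) = f := by
  induction f using tensor_induction with
  | h f => simp only [tensorComp_tprod, LinearMap.comp_id]
  | hs r x hx => simp only [map_smul, LinearMap.smul_apply, hx]
  | ha x y hx hy => simp only [map_add, LinearMap.add_apply, hx, hy]

theorem id_tensorComp (f : ⨂[K] _ : Fin n, U →ₗ[K] V) :
    tensorComp K n (PiTensorProduct.tprod K fun _ => LinearMap.id) f = f := by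
  induction f using tensor_induction with
  | h f => simp only [tensorComp_tprod, LinearMap.id_comp]
  | hs r x hx => simp only [map_smul, hx]
  | ha x y hx hy => simp only [map_add, hx, hy]

/-- The action of `Hom(U, V)^{⊗ n}` on tensors: `U^{⊗ n} → V^{⊗ n}`. -/
abbrev tensorEval : (⨂[K] _ : Fin n, U →ₗ[K] V) →ₗ[K]
    (⨂[K] _ : Fin n, U) →ₗ[K] (⨂[K] _ : Fin n, V) :=
  PiTensorProduct.piTensorHomMap

theorem tensorPerm_tensorEval (σ : SymGrp n) (f : ⨂[K] _ : Fin n, U →ₗ[K] V)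
    (x : ⨂[K] _ : Fin n, U) :
    tensorPerm K n _ σ (tensorEval K n f x) =
      tensorEval K n (tensorPerm K n _ σ f) (tensorPerm K n _ σ x) := by
  induction f using tensor_induction with
  | h f =>
    induction x using tensor_induction with
    | h x => simp only [PiTensorProduct.piTensorHomMap_tprod_tprod, tensorPerm_tprod]
    | hs r x hx => simp only [map_smul, hx]
    | ha x y hx hy => simp only [map_add, hx, hy]
  | hs r x hx => simp only [map_smul, LinearMap.smul_apply, hx]
  | ha x y hx hy => simp only [map_add, LinearMap.add_apply, hx, hy]

theorem tensorEval_tensorComp (g : ⨂[K] _ : Fin n, V →ₗ[K] W)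
    (f : ⨂[K] _ : Fin n, U →ₗ[K] V) (x : ⨂[K] _ : Fin n, U) :
    tensorEval K n (tensorComp K n g f) x = tensorEval K n g (tensorEval K n f x) := by
  induction g using tensor_induction with
  | h g =>
    induction f using tensor_induction with
    | h f =>
      induction x using tensor_induction with
      | h x =>
        simp only [PiTensorProduct.piTensorHomMap_tprod_tprod, tensorComp_tprod,
          LinearMap.comp_apply]
      | hs r x hx => simp only [map_smul, hx]
      | ha x y hx hy => simp only [map_add, hx, hy]
    | hs r x hx => simp only [map_smul, LinearMap.smul_apply, hx]
    | ha x y hx hy => simp only [map_add, LinearMap.add_apply, hx, hy]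
  | hs r x hx => simp only [map_smul, LinearMap.smul_apply, hx]
  | ha x y hx hy => simp only [map_add, LinearMap.add_apply, hx, hy]

theorem tensorEval_id (x : ⨂[K] _ : Fin n, U) :
    tensorEval K n (PiTensorProduct.tprod K fun _ => (LinearMap.id : U →ₗ[K] U)) x = x := by
  induction x using tensor_induction with
  | h x => simp only [PiTensorProduct.piTensorHomMap_tprod_tprod, LinearMap.id_apply]
  | hs r x hx => simp only [map_smul, hx]
  | ha x y hx hy => simp only [map_add, hx, hy]

/-- The canonical element `γ(x) = x^{⊗ n}` of `Γⁿ(X)`. -/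
def gam (x : V) : divPow K n V :=
  ⟨PiTensorProduct.tprod K fun _ => x, fun σ => tensorPerm_tprod K n σ fun _ => x⟩

/-- The composition law `Γⁿ(Hom(V, W)) × Γⁿ(Hom(U, V)) → Γⁿ(Hom(U, W))`: reorder the factors,
`Γⁿ(A) ⊗ Γⁿ(B) → Γⁿ(A ⊗ B)`, and then compose in each factor. -/
def divPowComp (g : divPow K n (V →ₗ[K] W)) (f : divPow K n (U →ₗ[K] V)) :
    divPow K n (U →ₗ[K] W) :=
  ⟨tensorComp K n g.1 f.1, fun σ => by rw [tensorPerm_tensorComp, g.2 σ, f.2 σ]⟩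

end Composition

end Gamma

/-- The objects of the category `Γⁿ𝒱` are the finite dimensional vector spaces. -/
structure GammaCat (K : Type u) [Field K] (n : ℕ) where
  /-- the underlying vector space -/
  V : FGModuleCat.{u} K

section Gamma

variable (K : Type u) [Field K] (n : ℕ)

variable {K n} in
/-- `Hom_{Γⁿ𝒱}(V, W) = Γⁿ(Hom(V, W))`. -/
instance : Category.{u} (GammaCat K n) where
  Hom X Y := divPow K n (X.V →ₗ[K] Y.V)
  id _ := gam K n LinearMap.id
  comp f g := divPowComp K n g f
  id_comp f := Subtype.ext (tensorComp_id K n f.1)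
  comp_id f := Subtype.ext (id_tensorComp K n f.1)
  assoc f g h := Subtype.ext (tensorComp_assoc K n h.1 g.1 f.1)

variable {K n} in
instance (X Y : GammaCat K n) : AddCommGroup (X ⟶ Y) :=
  inferInstanceAs (AddCommGroup (divPow K n (X.V →ₗ[K] Y.V)))

variable {K n} in
instance (X Y : GammaCat K n) : Module K (X ⟶ Y) :=
  inferInstanceAs (Module K (divPow K n (X.V →ₗ[K] Y.V)))

instance : Preadditive (GammaCat K n) where
  add_comp _ _ _ f f' g := Subtype.ext <| by
    change tensorComp K n g.1 (f.1 + f'.1) = tensorComp K n g.1 f.1 + tensorComp K n g.1 f'.1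
    exact map_add _ _ _
  comp_add _ _ _ f g g' := Subtype.ext <| by
    change tensorComp K n (g.1 + g'.1) f.1 = tensorComp K n g.1 f.1 + tensorComp K n g'.1 f.1
    rw [map_add, LinearMap.add_apply]

instance : Linear K (GammaCat K n) where
  smul_comp _ _ _ r f g := Subtype.ext <| by
    change tensorComp K n g.1 (r • f.1) = r • tensorComp K n g.1 f.1
    exact map_smul _ _ _
  comp_smul _ _ _ f r g := Subtype.ext <| by
    change tensorComp K n (r • g.1) f.1 = r • tensorComp K n g.1 f.1
    rw [map_smul, LinearMap.smul_apply]

end Gamma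

/-! ### Strict polynomial functors -/
section Pn

variable (K : Type u) [Field K] (n : ℕ)

/-- The functor `V ↦ V^{⊗ n}` from `Γⁿ𝒱` to representations of the symmetric group. -/
def iFun : GammaCat K n ⥤ FDRep K (SymGrp n) where
  obj X := FDRep.of (tensorPerm K n X.V)
  map {X Y} f :=
    { hom := FGModuleCat.ofHom (tensorEval K n f.1)
      comm := fun σ => FGModuleCat.hom_ext (LinearMap.ext fun x => by
        have h := (tensorPerm_tensorEval K n σ f.1 x).symm
        rw [f.2 σ] at h
        exact h) }
  map_id X := Action.hom_ext _ _ (FGModuleCat.hom_ext (LinearMap.ext fun x =>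
    tensorEval_id K n x))
  map_comp f g := Action.hom_ext _ _ (FGModuleCat.hom_ext (LinearMap.ext fun x =>
    tensorEval_tensorComp K n g.1 f.1 x))

instance : (iFun K n).Additive where
  map_add {_ _ f g} := Action.hom_ext _ _ (FGModuleCat.hom_ext
    ((tensorEval K n).map_add f.1 g.1))

instance : (iFun K n).Linear K where
  map_smul f r := Action.hom_ext _ _ (FGModuleCat.hom_ext
    ((tensorEval K n).map_smul r f.1))

/-- The category `𝒫ₙ` of homogeneous strict polynomial functors of degree `n`: the `K`-linear
functors from `Γⁿ𝒱` to finite dimensional vector spaces. -/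
abbrev PCat := LinFun K (GammaCat K n)

end Pn

section Finiteness

variable {K : Type u} [Field K] {n : ℕ}

/-- The coordinate space `Kⁿ` as an object of `Γⁿ𝒱`. -/
def stdObj : GammaCat K n := ⟨FGModuleCat.of K (Fin n → K)⟩

/-- The identity of every object of `Γⁿ𝒱` is a finite sum of morphisms which factor
through `Kⁿ`. -/
theorem exists_id_eq_sum (X : GammaCat K n) :
    ∃ (ι : Type) (_ : Fintype ι) (v : ι → (X ⟶ stdObj)) (w : ι → (stdObj ⟶ X)),
      𝟙 X = ∑ i, v i ≫ w i := by
  classical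
  let d := Module.finrank K X.V
  let b : Module.Basis (Fin d) K X.V := Module.finBasis K X.V
  -- the coordinate projectors
  let e : Fin d → (X.V →ₗ[K] X.V) := fun j => (b.coord j).smulRight (b j)
  have he : ∑ j, e j = LinearMap.id := by
    ext x
    simp only [e, LinearMap.sum_apply, LinearMap.smulRight_apply, Module.Basis.coord_apply,
      LinearMap.id_apply]
    exact b.sum_repr x
  have hee : ∀ i j, e i ∘ₗ e j = if i = j then e i else 0 := by
    intro i j
    ext x
    by_cases h : i = j
    · subst h; simp [e]
    · simp [e, h]
  let im : (Fin n → Fin d) → Finset (Fin d) := fun c => Finset.univ.image c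
  let ξ : Finset (Fin d) → (⨂[K] _ : Fin n, X.V →ₗ[K] X.V) := fun S =>
    ∑ c : Fin n → Fin d, if im c = S then PiTensorProduct.tprod K (fun i => e (c i)) else 0
  have hξinv : ∀ S, ξ S ∈ divPow K n (X.V →ₗ[K] X.V) := by
    intro S
    rw [mem_divPow]
    intro σ
    simp only [ξ, map_sum]
    refine Fintype.sum_equiv (Equiv.arrowCongr σ (Equiv.refl _)) _ _ fun c => ?_
    have h1 : im ((Equiv.arrowCongr σ (Equiv.refl (Fin d))) c) = im c := by
      ext j
      simp only [im, Finset.mem_image, Finset.mem_univ, true_and]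
      constructor
      · rintro ⟨i, hi⟩; exact ⟨σ.symm i, hi⟩
      · rintro ⟨i, hi⟩; exact ⟨σ i, by simpa using hi⟩
    rw [h1]
    split_ifs
    · rw [tensorPerm_tprod]; rfl
    · simp
  have hξsum : PiTensorProduct.tprod K (fun _ : Fin n => (LinearMap.id : X.V →ₗ[K] X.V)) =
      ∑ S, ξ S := by
    rw [← he, MultilinearMap.map_sum, Finset.sum_comm]
    refine Finset.sum_congr rfl fun c _ => ?_
    simp
  have hfac : ∀ S, ∃ (v : X ⟶ stdObj) (w : stdObj ⟶ X),
      (⟨ξ S, hξinv S⟩ : divPow K n (X.V →ₗ[K] X.V)) = (v ≫ w : X ⟶ X) := by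
    intro S
    by_cases hS : S.card ≤ n
    · obtain ⟨s⟩ : Nonempty (S ↪ Fin n) :=
        Function.Embedding.nonempty_of_card_le (by simpa using hS)
      let q : X.V →ₗ[K] (Fin n → K) :=
        ∑ j : S, (b.coord j).smulRight (Pi.single (s j) (1 : K))
      let r : (Fin n → K) →ₗ[K] X.V :=
        ∑ j : S, (LinearMap.proj (s j)).smulRight (b j)
      have hrq : r ∘ₗ q = ∑ j : S, e j := by
        ext x
        simp only [r, q, e, LinearMap.comp_apply, LinearMap.sum_apply,
          LinearMap.smulRight_apply, LinearMap.proj_apply, Finset.sum_apply, Pi.smul_apply,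
          smul_eq_mul]
        refine Finset.sum_congr rfl fun j _ => ?_
        congr 1
        rw [Finset.sum_eq_single j]
        · simp
        · intro k _ hk
          simp [s.injective.eq_iff, Ne.symm hk]
        · simp
      refine ⟨gam K n q, divPowComp K n ⟨ξ S, hξinv S⟩ (gam K n r), Subtype.ext ?_⟩
      change ξ S = tensorComp K n (tensorComp K n (ξ S) (PiTensorProduct.tprod K fun _ => r))
        (PiTensorProduct.tprod K fun _ => q)
      rw [← tensorComp_assoc, tensorComp_tprod, hrq]
      simp only [ξ, map_sum, LinearMap.sum_apply]
      refine Finset.sum_congr rfl fun c _ => ?_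
      split_ifs with hc
      · rw [tensorComp_tprod]
        congr 1
        funext i
        have hi : c i ∈ S := by rw [← hc]; simp [im]
        rw [← LinearMap.compRight_apply K, map_sum, Finset.sum_eq_single (⟨c i, hi⟩ : S)]
        · simp [hee]
        · intro k _ hk
          rw [LinearMap.compRight_apply, hee, if_neg]
          intro h
          exact hk (Subtype.ext h.symm)
        · simp
      · simp
    · refine ⟨0, 0, Subtype.ext ?_⟩
      rw [Limits.comp_zero]
      change ξ S = 0
      refine Finset.sum_eq_zero fun c _ => if_neg ?_
      rintro rfl
      exact hS (Finset.card_image_le.trans (by simp))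
  choose v w hvw using hfac
  refine ⟨Finset (Fin d), inferInstance, v, w, ?_⟩
  have : (∑ S, v S ≫ w S : X ⟶ X) =
      ∑ S, (⟨ξ S, hξinv S⟩ : divPow K n (X.V →ₗ[K] X.V)) :=
    Finset.sum_congr rfl fun S _ => (hvw S).symm
  rw [this]
  apply Subtype.ext
  rw [AddSubmonoidClass.coe_finsetSum]
  exact hξsum

/-- Evaluation of natural transformations at `Kⁿ`. -/
def evalStd (F G : PCat K n) : (F ⟶ G) →ₗ[K] (F.obj.obj stdObj ⟶ G.obj.obj stdObj) where
  toFun α := α.hom.app stdObj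
  map_add' _ _ := rfl
  map_smul' _ _ := rfl

theorem evalStd_injective (F G : PCat K n) : Function.Injective (evalStd F G) := by
  intro α β h
  refine ObjectProperty.hom_ext _ (NatTrans.ext (funext fun X => ?_))
  obtain ⟨ι, _, v, w, hid⟩ := exists_id_eq_sum X
  have key : ∀ γ : F ⟶ G, γ.hom.app X =
      ∑ i, F.obj.map (v i) ≫ evalStd F G γ ≫ G.obj.map (w i) := by
    intro γ
    rw [← Category.comp_id (γ.hom.app X), ← G.obj.map_id, hid, Functor.map_sum,
      Preadditive.comp_sum]
    refine Finset.sum_congr rfl fun i _ => ?_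
    rw [Functor.map_comp, ← Category.assoc, ← γ.hom.naturality, Category.assoc]
    rfl
  rw [key α, key β, h]

instance (F G : PCat K n) : Small.{u} (F ⟶ G) := small_of_injective (evalStd_injective F G)

instance (F G : PCat K n) : Module.Finite K (F ⟶ G) :=
  Module.Finite.of_injective (evalStd F G) (evalStd_injective F G)

end Finiteness

/-! ### Coherent functors -/
section Coherent

variable (K : Type u) [Field K] (G : Type) [Group G]

/-- The category `𝒜(G)` of `K`-linear functors from finite dimensional representations of `G`
to finite dimensional vector spaces. -/
abbrev ACat := LinFun K (FDRep K G)

/-- The coinvariants `H₀(G, -)`. -/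
def coinvFun : FDRep K G ⥤ FGModuleCat.{u} K where
  obj M := ⟨ModuleCat.of K (Representation.Coinvariants M.ρ),
    inferInstanceAs (Module.Finite K (_ ⧸ Representation.Coinvariants.ker M.ρ))⟩
  map {M N} f := ObjectProperty.homMk (ModuleCat.ofHom
    (Representation.Coinvariants.lift M.ρ
      (Representation.Coinvariants.mk N.ρ ∘ₗ f.hom.hom.hom) fun g => by
        ext x
        have h : f.hom.hom.hom (M.ρ g x) = N.ρ g (f.hom.hom.hom x) :=
          LinearMap.congr_fun (congrArg (fun φ => φ.hom.hom) (f.comm g)) x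
        simp [h]))
  map_id M := FGModuleCat.hom_ext (Representation.Coinvariants.hom_ext rfl)
  map_comp f g := FGModuleCat.hom_ext (Representation.Coinvariants.hom_ext rfl)

instance : (coinvFun K G).Additive where
  map_add := FGModuleCat.hom_ext (Representation.Coinvariants.hom_ext rfl)

instance : (coinvFun K G).Linear K where
  map_smul _ _ := FGModuleCat.hom_ext (Representation.Coinvariants.hom_ext rfl)

/-- The invariants `H⁰(G, -)`. -/
def invFun : FDRep K G ⥤ FGModuleCat.{u} K where
  obj M := FGModuleCat.of K (Representation.invariants M.ρ)
  map {M N} f := FGModuleCat.ofHom (f.hom.hom.hom.restrict fun x hx g => by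
    have h : f.hom.hom.hom (M.ρ g x) = N.ρ g (f.hom.hom.hom x) :=
      LinearMap.congr_fun (congrArg (fun φ => φ.hom.hom) (f.comm g)) x
    rw [← h, hx g])
  map_id M := rfl
  map_comp f g := rfl

instance : (invFun K G).Additive where
  map_add := rfl

instance : (invFun K G).Linear K where
  map_smul _ _ := rfl

/-- The functor `M ↦ 𝐭_M`, where `𝐭_M(X) = M ⊗_G X` is the space `(M ⊗ X)_G` of coinvariants for
the diagonal action (`M` is a right module through `m g = g⁻¹ m`). -/
def tFun : FDRep K G ⥤ ACat K G where
  obj M := ⟨tensorLeft M ⋙ coinvFun K G, inferInstance, inferInstance⟩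
  map f := ObjectProperty.homMk
    (Functor.whiskerRight ((curriedTensor (FDRep K G)).map f) (coinvFun K G))
  map_id M := by
    refine ObjectProperty.hom_ext _ (NatTrans.ext (funext fun X => ?_))
    simp
  map_comp f g := by
    refine ObjectProperty.hom_ext _ (NatTrans.ext (funext fun X => ?_))
    simp

instance : (tFun K G).Additive where
  map_add {M N f g} := ObjectProperty.hom_ext _ (NatTrans.ext (funext fun X => by
    change (coinvFun K G).map ((f + g) ▷ X) =
      (coinvFun K G).map (f ▷ X) + (coinvFun K G).map (g ▷ X)
    rw [MonoidalPreadditive.add_whiskerRight, Functor.map_add]))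

instance : (tFun K G).Linear K where
  map_smul f r := ObjectProperty.hom_ext _ (NatTrans.ext (funext fun X => by
    change (coinvFun K G).map ((r • f) ▷ X) = r • (coinvFun K G).map (f ▷ X)
    rw [MonoidalLinear.smul_whiskerRight, Functor.map_smul]))

/-- The functor `M ↦ (X ↦ (M ⊗ X)^G)`. -/
def uFun : FDRep K G ⥤ ACat K G where
  obj M := ⟨tensorLeft M ⋙ invFun K G, inferInstance, inferInstance⟩
  map f := ObjectProperty.homMk
    (Functor.whiskerRight ((curriedTensor (FDRep K G)).map f) (invFun K G))
  map_id M := by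
    refine ObjectProperty.hom_ext _ (NatTrans.ext (funext fun X => ?_))
    simp
  map_comp f g := by
    refine ObjectProperty.hom_ext _ (NatTrans.ext (funext fun X => ?_))
    simp

/-- The functor `M ↦ 𝐡_M = Hom_G(M, -)`. -/
abbrev hG : (FDRep K G)ᵒᵖ ⥤ ACat K G := hFun K (FDRep K G)

/-- Duality of finite dimensional representations. -/
def dualRep : (FDRep K G)ᵒᵖ ⥤ FDRep K G where
  obj M := FDRep.of (Representation.dual M.unop.ρ)
  map {M N} f :=
    { hom := FGModuleCat.ofHom f.unop.hom.hom.hom.dualMap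
      comm := fun g => FGModuleCat.hom_ext (LinearMap.ext fun φ => LinearMap.ext fun x => by
        have h : f.unop.hom.hom.hom (N.unop.ρ g⁻¹ x) = M.unop.ρ g⁻¹ (f.unop.hom.hom.hom x) :=
          LinearMap.congr_fun (congrArg (fun φ => φ.hom.hom) (f.unop.comm g⁻¹)) x
        exact congrArg φ h.symm) }
  map_id _ := rfl
  map_comp _ _ := rfl

theorem dualRep_map_add {M N : FDRep K G} (f g : M ⟶ N) :
    (dualRep K G).map (f + g).op = (dualRep K G).map f.op + (dualRep K G).map g.op :=
  Action.hom_ext _ _ (dualV_map_add K f.hom g.hom)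

theorem dualRep_map_smul {M N : FDRep K G} (r : K) (f : M ⟶ N) :
    (dualRep K G).map (r • f).op = r • (dualRep K G).map f.op :=
  Action.hom_ext _ _ (dualV_map_smul K r f.hom)

/-- A functor `𝐟` is coherent if there is an exact sequence `𝐡_N → 𝐡_M → 𝐟 → 0`. -/
def isCoherent : ObjectProperty (ACat K G) := fun f =>
  ∃ (M N : FDRep K G) (a : (hG K G).obj (op N) ⟶ (hG K G).obj (op M))
    (q : (hG K G).obj (op M) ⟶ f), ∀ X : FDRep K G,
      Function.Exact (a.hom.app X).hom.hom (q.hom.app X).hom.hom ∧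
        Function.Surjective (q.hom.app X).hom.hom

/-- The category `𝒞(G)` of coherent functors. -/
abbrev CCat := (isCoherent K G).FullSubcategory

theorem isCoherent_h (M : (FDRep K G)ᵒᵖ) : isCoherent K G ((hG K G).obj M) := by
  refine ⟨M.unop, M.unop, 0, 𝟙 _, fun X => ⟨fun x => ?_, fun x => ⟨x, rfl⟩⟩⟩
  change x = 0 ↔ ∃ y, 0 = x
  exact ⟨fun h => ⟨0, h.symm⟩, fun ⟨_, h⟩ => h.symm⟩

variable [Finite G]

instance (X : Type) [Finite X] : Module.Finite K (MonoidAlgebra K X) :=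
  Module.Finite.equiv (MonoidAlgebra.coeffLinearEquiv (R := K) (S := K) (M := X)).symm

/-- The permutation representation on a finite `G`-set. -/
abbrev permRep (X : Type) [Finite X] [MulAction G X] : FDRep K G :=
  FDRep.of (Representation.ofMulAction K G X)

/-- The group algebra as a representation, `G` acting by left multiplication. -/
abbrev regRep : FDRep K G := permRep K G G

/-- The endomorphism `x ↦ x g⁻¹` of the representation `K[G]`. -/
def regRight (g : G) : regRep K G ⟶ regRep K G where
  hom := FGModuleCat.ofHom (LinearMap.mulRight K (MonoidAlgebra.single g⁻¹ (1 : K)))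
  comm h := FGModuleCat.hom_ext (by
    change LinearMap.mulRight K (MonoidAlgebra.single g⁻¹ (1 : K)) ∘ₗ
        Representation.ofMulAction K G G h =
      Representation.ofMulAction K G G h ∘ₗ
        LinearMap.mulRight K (MonoidAlgebra.single g⁻¹ (1 : K))
    ext x : 2
    simp [Representation.ofMulAction_single, MonoidAlgebra.single_mul_single, mul_assoc])

theorem regRight_one : regRight K G 1 = 𝟙 _ :=
  Action.hom_ext _ _ (FGModuleCat.hom_ext (LinearMap.ext fun x => by
    change x * MonoidAlgebra.single (1 : G)⁻¹ (1 : K) = x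
    rw [inv_one]
    exact mul_one x))

theorem regRight_mul (g h : G) : regRight K G (g * h) = regRight K G h ≫ regRight K G g :=
  Action.hom_ext _ _ (FGModuleCat.hom_ext (LinearMap.ext fun x => by
    change x * MonoidAlgebra.single (g * h)⁻¹ (1 : K) =
      x * MonoidAlgebra.single h⁻¹ (1 : K) * MonoidAlgebra.single g⁻¹ (1 : K)
    rw [mul_assoc, MonoidAlgebra.single_mul_single, mul_inv_rev, mul_one]))

/-- The functor `t^*(𝐟) = 𝐟(K[G])`, with the left action of `G` that comes from right
multiplications on `K[G]`. -/
def tUp : CCat K G ⥤ FDRep K G where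
  obj f :=
    { V := f.obj.obj.obj (regRep K G)
      ρ :=
        { toFun := fun g => f.obj.obj.map (regRight K G g)
          map_one' := by rw [regRight_one, CategoryTheory.Functor.map_id]; rfl
          map_mul' := fun g h => by rw [regRight_mul, Functor.map_comp]; rfl } }
  map α :=
    { hom := α.hom.hom.app _
      comm := fun g => α.hom.hom.naturality _ }
  map_id _ := rfl
  map_comp _ _ := rfl

/-- The functor `t_*(M) = 𝐡_{M^∨}`. -/
def tLow : FDRep K G ⥤ CCat K G :=
  (isCoherent K G).lift ((dualRep K G).rightOp ⋙ hG K G) fun _ => isCoherent_h K G _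

/-- The full subcategory `𝒞⁰(G)` of the coherent functors `𝐟` with `t^*(𝐟) = 0`. -/
def isC0 : ObjectProperty (CCat K G) := fun f => IsZero ((tUp K G).obj f)

end Coherent

/-! ### The functors between the three categories -/
section Functors

variable (K : Type u) [Field K] (n : ℕ)

/-- Restriction along `V ↦ V^{⊗ n}`, on all linear functors. -/
def jUpA : ACat K (SymGrp n) ⥤ PCat K n := precomp K (iFun K n)

instance : (jUpA K n).Additive := inferInstanceAs (precomp K (iFun K n)).Additive

instance : (jUpA K n).Linear K := inferInstanceAs ((precomp K (iFun K n)).Linear K)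

/-- The functor `j^* : 𝒞ₙ → 𝒫ₙ`, `j^*(𝐟)(V) = 𝐟(V^{⊗ n})`. -/
def jUp : CCat K (SymGrp n) ⥤ PCat K n := (isCoherent K (SymGrp n)).ι ⋙ jUpA K n

/-- The functor of `n`-th tensor power, an object of `𝒫ₙ`. -/
def tensorPow : PCat K n :=
  ⟨iFun K n ⋙ Action.forget _ _, inferInstance, inferInstance⟩

/-- The action of the symmetric group on the functor `Tⁿ`. -/
def tensorPowPerm (σ : SymGrp n) : tensorPow K n ⟶ tensorPow K n :=
  ObjectProperty.homMk
    { app := fun X => Action.ρ ((iFun K n).obj X) σ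
      naturality := fun _ _ f => (((iFun K n).map f).comm σ).symm }

theorem tensorPowPerm_one : tensorPowPerm K n 1 = 𝟙 _ :=
  ObjectProperty.hom_ext _ (NatTrans.ext (funext fun X => Action.ρ_one ((iFun K n).obj X)))

theorem tensorPowPerm_mul (σ τ : SymGrp n) :
    tensorPowPerm K n (σ * τ) = tensorPowPerm K n τ ≫ tensorPowPerm K n σ :=
  ObjectProperty.hom_ext _ (NatTrans.ext (funext fun X =>
    map_mul (Action.ρ ((iFun K n).obj X)) σ τ))

/-- The linearization functor `c^*(F) = Hom(Tⁿ, F)`, on which `σ` acts by `φ ↦ φ ∘ σ⁻¹`. -/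
def cUp : PCat K n ⥤ FDRep K (SymGrp n) where
  obj F :=
    { V := ((homFun K (PCat K n)).obj (op (tensorPow K n))).obj F
      ρ :=
        { toFun := fun σ => ((homFun K (PCat K n)).map (tensorPowPerm K n σ⁻¹).op).app F
          map_one' := by
            rw [inv_one, tensorPowPerm_one, op_id, CategoryTheory.Functor.map_id]; rfl
          map_mul' := fun σ τ => by
            rw [mul_inv_rev, tensorPowPerm_mul, op_comp, Functor.map_comp]; rfl } }
  map α :=
    { hom := ((homFun K (PCat K n)).obj (op (tensorPow K n))).map α
      comm := fun σ =>
        (((homFun K (PCat K n)).map (tensorPowPerm K n σ⁻¹).op).naturality α).symm }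
  map_id F := Action.hom_ext _ _
    (CategoryTheory.Functor.map_id ((homFun K (PCat K n)).obj (op (tensorPow K n))) F)
  map_comp α β := Action.hom_ext _ _
    (Functor.map_comp ((homFun K (PCat K n)).obj (op (tensorPow K n))) α β)

/-- The functor `c_!(M)(V) = (M ⊗ V^{⊗ n})_{𝔖ₙ}`. -/
def cShriek : FDRep K (SymGrp n) ⥤ PCat K n := tFun K (SymGrp n) ⋙ jUpA K n

/-- The functor `c_*(M)(V) = (M ⊗ V^{⊗ n})^{𝔖ₙ}`. -/
def cLow : FDRep K (SymGrp n) ⥤ PCat K n := uFun K (SymGrp n) ⋙ jUpA K n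

/-- The contravariant functor `M ↦ j^*(𝐡_M)`. -/
def hPow : (FDRep K (SymGrp n))ᵒᵖ ⥤ PCat K n := hG K (SymGrp n) ⋙ jUpA K n

theorem hPow_map_add {M N : FDRep K (SymGrp n)} (f g : M ⟶ N) :
    (hPow K n).map (f + g).op = (hPow K n).map f.op + (hPow K n).map g.op :=
  (congrArg (jUpA K n).map (hFun_map_add K _ f g)).trans ((jUpA K n).map_add)

theorem hPow_map_smul {M N : FDRep K (SymGrp n)} (r : K) (f : M ⟶ N) :
    (hPow K n).map (r • f).op = r • (hPow K n).map f.op :=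
  (congrArg (jUpA K n).map (hFun_map_smul K _ r f)).trans ((jUpA K n).map_smul r _)

/-- The functor `j_* : 𝒫ₙ → 𝒜ₙ`, `j_*(F)(M) = Hom(j^*(𝐡_M), F)`. -/
def jLowA : PCat K n ⥤ ACat K (SymGrp n) :=
  (isLinearFunctor K (FDRep K (SymGrp n))).lift
    ((homFun K (PCat K n)).flip ⋙ (Functor.whiskeringLeft _ _ _).obj (hPow K n).rightOp)
    fun F =>
      ⟨{ map_add := fun {_ _ f g} => by
          change ((homFun K (PCat K n)).map ((hPow K n).map (f + g).op).op).app F = _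
          rw [hPow_map_add]
          exact homFun_map_add_app K _ _ _ F },
       { map_smul := fun f r => by
          change ((homFun K (PCat K n)).map ((hPow K n).map (r • f).op).op).app F = _
          rw [hPow_map_smul]
          exact homFun_map_smul_app K _ _ _ F }⟩

/-- The contravariant functor `M ↦ j^*(𝐭_{M^∨}) = (-)^{⊗ n} ⊗_{𝔖ₙ} M^∨`. -/
def tDualPow : (FDRep K (SymGrp n))ᵒᵖ ⥤ PCat K n := dualRep K (SymGrp n) ⋙ tFun K (SymGrp n) ⋙ jUpA K n

theorem tDualPow_map_add {M N : FDRep K (SymGrp n)} (f g : M ⟶ N) :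
    (tDualPow K n).map (f + g).op = (tDualPow K n).map f.op + (tDualPow K n).map g.op :=
  (congrArg (tFun K (SymGrp n) ⋙ jUpA K n).map (dualRep_map_add K _ f g)).trans
    ((tFun K (SymGrp n) ⋙ jUpA K n).map_add)

theorem tDualPow_map_smul {M N : FDRep K (SymGrp n)} (r : K) (f : M ⟶ N) :
    (tDualPow K n).map (r • f).op = r • (tDualPow K n).map f.op :=
  (congrArg (tFun K (SymGrp n) ⋙ jUpA K n).map (dualRep_map_smul K _ r f)).trans
    ((tFun K (SymGrp n) ⋙ jUpA K n).map_smul r _)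

/-- The functor `j_! : 𝒫ₙ → 𝒜ₙ`, `j_!(F)(M) = Hom(F, (-)^{⊗ n} ⊗_{𝔖ₙ} M^∨)^∨`. -/
def jShriekA : PCat K n ⥤ ACat K (SymGrp n) :=
  (isLinearFunctor K (FDRep K (SymGrp n))).lift
    ((homFun K (PCat K n) ⋙ (Functor.whiskeringLeft _ _ _).obj (tDualPow K n)).rightOp ⋙
      dualFun K _)
    fun F =>
      ⟨{ map_add := fun {_ _ f g} => by
          change (dualV K).map (((homFun K (PCat K n)).obj (op F)).map
            ((tDualPow K n).map (f + g).op)).op = _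
          rw [tDualPow_map_add, Functor.map_add]
          exact dualV_map_add K _ _ },
       { map_smul := fun f r => by
          change (dualV K).map (((homFun K (PCat K n)).obj (op F)).map
            ((tDualPow K n).map (r • f).op)).op = _
          rw [tDualPow_map_smul, Functor.map_smul]
          exact dualV_map_smul K r _ }⟩

/-- The full subcategory `𝒫⁰ₙ` of the functors `F` with `c^*(F) = 0`. -/
def isP0 : ObjectProperty (PCat K n) := fun F => IsZero ((cUp K n).obj F)

end Functors

/-! ### Young permutation modules -/
section Young

variable {n : ℕ}

/-- The parts of a partition of `n`, in decreasing order, as a composition of `n`. -/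
def partComposition (lam : n.Partition) : Composition n where
  blocks := lam.parts.sort (· ≥ ·)
  blocks_pos h := lam.parts_pos ((Multiset.mem_sort _).1 h)
  blocks_sum := by
    rw [← Multiset.sum_coe, Multiset.sort_eq, lam.parts_sum]

/-- The Young subgroup `𝔖_λ`: the permutations which preserve each of the consecutive blocks
of lengths `λ₁ ≥ λ₂ ≥ ⋯`. -/
def youngSubgroup (lam : n.Partition) : Subgroup (SymGrp n) where
  carrier := {σ | ∀ i, (partComposition lam).index (σ i) = (partComposition lam).index i}
  one_mem' _ := rfl
  mul_mem' {σ τ} hσ hτ i := (hσ (τ i)).trans (hτ i)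
  inv_mem' {σ} hσ i := by
    have h := hσ (σ⁻¹ i)
    rw [show σ (σ⁻¹ i) = i from σ.apply_symm_apply i] at h
    exact h.symm

/-- The full subcategory `𝒞^Y` of the coherent functors which vanish on all the Young permutation
representations `K[𝔖ₙ/𝔖_λ]`. -/
def isCY (K : Type u) [Field K] (n : ℕ) : ObjectProperty (CCat K (SymGrp n)) := fun f =>
  ∀ lam : n.Partition, IsZero (f.obj.obj.obj (permRep K (SymGrp n) (SymGrp n ⧸ youngSubgroup lam)))

end Young

end PolyRec

end

open CategoryTheory PolyRec

/-! Everything rests on the regular representation `K[𝔖ₙ]`. It is a direct summand of `(Kⁿ)^{⊗ n}`,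
spanned by the orbit of `e₁ ⊗ ⋯ ⊗ eₙ` (`regIncl_regProj`), and every composite `V^{⊗ n} → K[𝔖ₙ] →
W^{⊗ n}` is a norm `∑ σ (ξ ⊗ v) σ⁻¹`, hence comes from `Γⁿ(Hom(V, W))` (`exists_iFun_map`). So a
natural transformation `j^*(f) → j^*(g)`, which a priori respects only the morphisms of `Γⁿ𝒱`,
induces a map `f(K[𝔖ₙ]) → g(K[𝔖ₙ])` compatible with all equivariant maps between `K[𝔖ₙ]` and tensor
powers, and with the endomorphisms of `K[𝔖ₙ]`.

Three computations follow. The forgetful functor is represented by `K[𝔖ₙ]`, so `Hom(Tⁿ, j^*(f)) =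
f(K[𝔖ₙ])`, which is the middle diagram. The elements of `𝐭_M(X)` come from `𝐭_M(K[𝔖ₙ]) = M`, so
`c_!` is fully faithful (`cShriek_map_preimage`); since `𝐭_M(N)` is dual to `Hom(M, N^∨)`, this
gives `j_!(c_!(M))(N) = Hom(c_!(M), c_!(N^∨))^∨ = 𝐭_M(N)`. Dually, `𝐡_M` is detected by maps into
`K[𝔖ₙ]`, where it takes the value `M^∨`, so `M ↦ j^*(𝐡_M)` is fully faithful (`hG_map_preimage`) and
`j_*(j^*(𝐡_L)) = 𝐡_L`; the left diagram follows because `(M ⊗ X)^G = Hom_G(M^∨, X)`. The inclusion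
`𝒞^Y ⊆ 𝒞⁰` holds because the Young subgroup of `(1, …, 1)` is trivial.

For coherence, morphisms `F → T` in `𝒫ₙ` are the linear maps `F(Kⁿ) → T(Kⁿ)` that commute with
`End(Kⁿ)` in `Γⁿ𝒱`, the Schur algebra (`exists_stdVal_eq`). Dualizing this kernel presents `j_!(F)`
by finitely many generators and relations, and then `𝐭_M`, isomorphic to `j_!(c_!(M))`, is coherent
too. Finally `j_*(F)(M)` is the kernel of a commutator on `Hom(Hom(M, L), F(Kⁿ))` with `L = (Kⁿ)^{⊗
n}`; as a functor of `M` this space is a finite sum of copies of `𝐭_{L^∨}`, and pushouts of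
representations supply the kernel with a generator and its relations. -/

noncomputable section
namespace PolyRec
open CategoryTheory Limits Opposite MonoidalCategory
open scoped TensorProduct

/-! ### Morphisms from and to the regular representation -/

section Representations

variable {K : Type u} [Field K] {G : Type} [Group G]

/-- The linear map underlying a morphism of representations. -/
abbrev linOf {M N : FDRep K G} (f : M ⟶ N) : M →ₗ[K] N := f.hom.hom.hom

theorem linOf_comm {M N : FDRep K G} (f : M ⟶ N) (g : G) (x : M) :
    linOf f (M.ρ g x) = N.ρ g (linOf f x) :=
  LinearMap.congr_fun (congrArg (fun φ => φ.hom.hom) (f.comm g)) x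

theorem fdRep_hom_ext {M N : FDRep K G} {f g : M ⟶ N} (h : ∀ x, linOf f x = linOf g x) : f = g :=
  Action.hom_ext _ _ (FGModuleCat.hom_ext (LinearMap.ext h))

/-- An equivariant linear map as a morphism of representations. -/
def homOfLin {M N : FDRep K G} (f : M →ₗ[K] N) (h : ∀ g x, f (M.ρ g x) = N.ρ g (f x)) :
    M ⟶ N where
  hom := FGModuleCat.ofHom f
  comm g := FGModuleCat.hom_ext (LinearMap.ext (h g))

theorem linOf_comp {L M N : FDRep K G} (f : L ⟶ M) (g : M ⟶ N) (x : L) :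
    linOf (f ≫ g) x = linOf g (linOf f x) := rfl

theorem linOf_add {M N : FDRep K G} (f g : M ⟶ N) (x : M) :
    linOf (f + g) x = linOf f x + linOf g x := rfl

theorem linOf_smul {M N : FDRep K G} (r : K) (f : M ⟶ N) (x : M) :
    linOf (r • f) x = r • linOf f x := rfl

/-- `linOf` as a linear map. -/
def linOfₗ (M N : FDRep K G) : (M ⟶ N) →ₗ[K] M →ₗ[K] N where
  toFun f := linOf f
  map_add' _ _ := rfl
  map_smul' _ _ := rfl

section Regular

variable [Finite G]

/-- The morphism from the regular representation which sends `1` to `v`. -/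
def fromReg (X : FDRep K G) (v : X) : regRep K G ⟶ X :=
  homOfLin (M := regRep K G) ((Representation.asAlgebraHom X.ρ).toLinearMap.flip v) fun g x => by
    have h : (Representation.ofMulAction K G G g x : MonoidAlgebra K G) =
        MonoidAlgebra.single g 1 * x := by
      rw [← Representation.asAlgebraHom_ofMulAction_smul_eq_mul, Representation.asAlgebraHom_single,
        one_smul]
    change Representation.asAlgebraHom X.ρ (Representation.ofMulAction K G G g x) v =
      X.ρ g (Representation.asAlgebraHom X.ρ x v)
    rw [h, map_mul, Representation.asAlgebraHom_single, one_smul]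
    rfl

/-- The basis element `g` of the regular representation. -/
def regElt (g : G) : regRep K G := (MonoidAlgebra.single g (1 : K) : MonoidAlgebra K G)

theorem fromReg_regElt {X : FDRep K G} (v : X) (g : G) :
    linOf (fromReg X v) (regElt g) = X.ρ g v := by
  change Representation.asAlgebraHom X.ρ (MonoidAlgebra.single g 1) v = _
  rw [Representation.asAlgebraHom_single, one_smul]

theorem fromReg_one {X : FDRep K G} (v : X) : linOf (fromReg X v) (regElt 1) = v := by
  rw [fromReg_regElt, map_one, Module.End.one_apply]

theorem rho_regElt (g h : G) : (regRep K G).ρ g (regElt h) = regElt (g * h) :=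
  Representation.ofMulAction_single g h (1 : K)

/-- The orbit of the neutral element is a basis of `K[G]`, so `Hom_G(K[G], X) = X`. -/
theorem regRep_hom_ext {X : FDRep K G} {a b : regRep K G ⟶ X}
    (h : linOf a (regElt 1) = linOf b (regElt 1)) : a = b := by
  have key : linOf a = linOf b := by
    refine MonoidAlgebra.lhom_ext' fun g => LinearMap.ext_ring ?_
    change linOf a (regElt g) = linOf b (regElt g)
    rw [← mul_one g, ← rho_regElt, linOf_comm, linOf_comm, h]
  exact fdRep_hom_ext fun x => LinearMap.congr_fun key x

theorem fromReg_linOf {X : FDRep K G} (a : regRep K G ⟶ X) :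
    fromReg X (linOf a (regElt 1)) = a :=
  regRep_hom_ext (fromReg_one _)

theorem fromReg_comp {X Z : FDRep K G} (v : X) (f : X ⟶ Z) :
    fromReg X v ≫ f = fromReg Z (linOf f v) :=
  regRep_hom_ext (by rw [linOf_comp, fromReg_one, fromReg_one])

/-- `fromReg` as a linear map. -/
def fromRegₗ (X : FDRep K G) : X →ₗ[K] (regRep K G ⟶ X) where
  toFun := fromReg X
  map_add' _ _ := regRep_hom_ext (by rw [linOf_add, fromReg_one, fromReg_one, fromReg_one])
  map_smul' _ _ := regRep_hom_ext (by
    rw [RingHom.id_apply, linOf_smul, fromReg_one, fromReg_one])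

theorem linOf_regRight (g : G) : linOf (regRight K G g) (regElt 1) = regElt g⁻¹ := by
  change (MonoidAlgebra.single 1 1 * MonoidAlgebra.single g⁻¹ 1 : MonoidAlgebra K G) =
    MonoidAlgebra.single g⁻¹ 1
  rw [MonoidAlgebra.single_mul_single, one_mul, one_mul]

/-- The coefficient of the neutral element. -/
def coeffOne : regRep K G →ₗ[K] K :=
  Finsupp.lapply (1 : G) ∘ₗ (MonoidAlgebra.coeffLinearEquiv K (S := K) (M := G)).toLinearMap

/-- The morphism to the regular representation with `coeffOne ∘ toReg ξ = ξ`. -/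
def toReg (X : FDRep K G) (ξ : X →ₗ[K] K) : X ⟶ regRep K G :=
  homOfLin (N := regRep K G)
    ((MonoidAlgebra.coeffLinearEquiv K (S := K) (M := G)).symm.toLinearMap ∘ₗ
      (Finsupp.linearEquivFunOnFinite K K G).symm.toLinearMap ∘ₗ
      LinearMap.pi fun g => ξ ∘ₗ X.ρ g⁻¹) fun g x => by
    refine MonoidAlgebra.coeff_injective (Finsupp.ext fun h => ?_)
    refine Eq.trans ?_ (Representation.coeff_ofMulAction g _ h).symm
    change ξ (X.ρ h⁻¹ (X.ρ g x)) = ξ (X.ρ (g⁻¹ • h)⁻¹ x)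
    rw [← Module.End.mul_apply, ← map_mul, smul_eq_mul, mul_inv_rev, inv_inv]

theorem coeffOne_toReg {X : FDRep K G} (ξ : X →ₗ[K] K) (x : X) :
    coeffOne (linOf (toReg X ξ) x) = ξ x := by
  change ξ (X.ρ 1⁻¹ x) = ξ x
  rw [inv_one, map_one, Module.End.one_apply]

/-- By equivariance, the coefficient of `g` in the image of `x` is the coefficient of `1` in the
image of `g⁻¹ x`. This is the Frobenius reciprocity `Hom_G(X, K[G]) = X^*`. -/
theorem hom_regRep_ext {X : FDRep K G} {a b : X ⟶ regRep K G}
    (h : ∀ x, coeffOne (linOf a x) = coeffOne (linOf b x)) : a = b := by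
  have key : ∀ (c : X ⟶ regRep K G) (x : X) (g : G),
      (show MonoidAlgebra K G from linOf c x).coeff g = coeffOne (linOf c (X.ρ g⁻¹ x)) := by
    intro c x g
    rw [linOf_comm]
    refine Eq.trans ?_ (Representation.coeff_ofMulAction g⁻¹ _ 1).symm
    rw [inv_inv, smul_eq_mul, mul_one]
  refine fdRep_hom_ext fun x => MonoidAlgebra.coeff_injective (Finsupp.ext fun g => ?_)
  exact (key a x g).trans ((h _).trans (key b x g).symm)

theorem toReg_coeffOne {X : FDRep K G} (a : X ⟶ regRep K G) :
    toReg X (coeffOne ∘ₗ linOf a) = a :=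
  hom_regRep_ext fun x => coeffOne_toReg _ x

theorem comp_toReg {X Z : FDRep K G} (f : X ⟶ Z) (ξ : Z →ₗ[K] K) :
    f ≫ toReg Z ξ = toReg X (ξ ∘ₗ linOf f) :=
  hom_regRep_ext fun x => by
    rw [linOf_comp, coeffOne_toReg, coeffOne_toReg, LinearMap.comp_apply]

/-- `toReg` as a linear map. -/
def toRegₗ (X : FDRep K G) : (X →ₗ[K] K) →ₗ[K] (X ⟶ regRep K G) where
  toFun := toReg X
  map_add' _ _ := hom_regRep_ext fun x => by
    rw [linOf_add, map_add, coeffOne_toReg, coeffOne_toReg, coeffOne_toReg, LinearMap.add_apply]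
  map_smul' _ _ := hom_regRep_ext fun x => by
    rw [RingHom.id_apply, linOf_smul, map_smul, coeffOne_toReg, coeffOne_toReg,
      LinearMap.smul_apply]

/-- Maps that factor through `K[G]` are norms of rank one operators; `exists_tensorEval_eq_sum`
realizes exactly this expression by a divided power. -/
theorem toReg_comp_fromReg [Fintype G] {X Z : FDRep K G} (ξ : X →ₗ[K] K) (v : Z) (x : X) :
    linOf (toReg X ξ ≫ fromReg Z v) x = ∑ g : G, ξ (X.ρ g⁻¹ x) • Z.ρ g v := by
  have h : (linOf (toReg X ξ) x : regRep K G) = ∑ g : G, ξ (X.ρ g⁻¹ x) • regElt g := by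
    refine MonoidAlgebra.coeff_injective (Finsupp.ext fun h => ?_)
    classical
    change ξ (X.ρ h⁻¹ x) = (∑ g : G, ξ (X.ρ g⁻¹ x) • MonoidAlgebra.single g (1 : K) :
      MonoidAlgebra K G).coeff h
    simp [Finsupp.single_apply]
  rw [linOf_comp, h, map_sum]
  exact Finset.sum_congr rfl fun g _ => by rw [map_smul, fromReg_regElt]

theorem coeffOne_regElt_one : coeffOne (regElt (K := K) (1 : G)) = 1 := by
  change (MonoidAlgebra.single (1 : G) (1 : K)).coeff 1 = 1
  rw [MonoidAlgebra.coeff_single, Finsupp.single_eq_same]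

theorem coeffOne_regElt_ne {g : G} (h : g ≠ 1) : coeffOne (regElt (K := K) g) = 0 := by
  change (MonoidAlgebra.single g (1 : K)).coeff 1 = 0
  rw [MonoidAlgebra.coeff_single, Finsupp.single_eq_of_ne h.symm]

theorem regElt_induction {P : Type*} [AddCommGroup P] [Module K P] {a b : regRep K G →ₗ[K] P}
    (h : ∀ g, a (regElt g) = b (regElt g)) : a = b :=
  MonoidAlgebra.lhom_ext' fun g => LinearMap.ext_ring (h g)

/-- A criterion for `K[G]` to be a retract of `X`: a vector and a form whose matrix coefficient is
the delta function at `1`. It serves for `(Kⁿ)^{⊗ n}` and for cosets of a trivial subgroup. -/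
theorem fromReg_comp_toReg {X : FDRep K G} {v : X} {ξ : X →ₗ[K] K}
    (h : ∀ g, ξ (X.ρ g v) = coeffOne (regElt g)) : fromReg X v ≫ toReg X ξ = 𝟙 (regRep K G) := by
  refine hom_regRep_ext fun x => LinearMap.congr_fun
    (f := coeffOne ∘ₗ linOf (fromReg X v ≫ toReg X ξ)) (g := coeffOne)
    (regElt_induction fun g => ?_) x
  rw [LinearMap.comp_apply, linOf_comp, coeffOne_toReg, fromReg_regElt, h]

end Regular

end Representations

/-! ### The regular representation inside the tensor powers -/

section TensorPowers

variable {K : Type u} [Field K] {n : ℕ}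

theorem tensorEval_smulRight {U W : Type*} [AddCommGroup U] [Module K U] [AddCommGroup W]
    [Module K W] (η : Fin n → Module.Dual K U) (w : Fin n → W) (y : ⨂[K] _ : Fin n, U) :
    tensorEval K n (PiTensorProduct.tprod K fun i => (η i).smulRight (w i)) y =
      PiTensorProduct.dualDistrib (PiTensorProduct.tprod K η) y • PiTensorProduct.tprod K w := by
  induction y using tensor_induction with
  | h y =>
    rw [PiTensorProduct.piTensorHomMap_tprod_tprod, PiTensorProduct.dualDistrib_apply,
      ← MultilinearMap.map_smul_univ]
    rfl
  | hs r y hy => rw [map_smul, hy, map_smul, smul_assoc]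
  | ha y y' hy hy' => rw [map_add, hy, hy', map_add, add_smul]

/-- For pure tensors `ξ = ⊗ ηᵢ` and `v = ⊗ wᵢ` the operator is the sum of the `𝔖ₙ`-translates of `⊗
(ηᵢ ⊗ wᵢ)`, which is visibly invariant. The general case follows by linearity in both arguments. -/
theorem exists_tensorEval_eq_sum {U W : Type*} [AddCommGroup U] [Module K U] [Module.Finite K U]
    [AddCommGroup W] [Module K W] (ξ : Module.Dual K (⨂[K] _ : Fin n, U))
    (v : ⨂[K] _ : Fin n, W) :
    ∃ f : divPow K n (U →ₗ[K] W), ∀ x, tensorEval K n f.1 x =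
      ∑ σ : SymGrp n, ξ (tensorPerm K n U σ⁻¹ x) • tensorPerm K n W σ v := by
  have key : ∀ (η : ⨂[K] _ : Fin n, Module.Dual K U) (w : ⨂[K] _ : Fin n, W),
      ∃ f : divPow K n (U →ₗ[K] W), ∀ x, tensorEval K n f.1 x = ∑ σ : SymGrp n,
        PiTensorProduct.dualDistrib η (tensorPerm K n U σ⁻¹ x) • tensorPerm K n W σ w := by
    intro η w
    induction η using tensor_induction with
    | h η =>
      induction w using tensor_induction with
      | h w =>
        refine ⟨⟨∑ σ, tensorPerm K n _ σ
          (PiTensorProduct.tprod K fun i => (η i).smulRight (w i)), fun τ => ?_⟩, fun x => ?_⟩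
        · rw [map_sum]
          refine Fintype.sum_equiv (Equiv.mulLeft τ) _ _ fun σ => ?_
          rw [← Module.End.mul_apply, ← map_mul]
          rfl
        · rw [map_sum, LinearMap.sum_apply]
          refine Finset.sum_congr rfl fun σ _ => ?_
          -- Inserting `σ σ⁻¹` lets the equivariance of evaluation turn a translated tensor into a
          -- conjugated operator.
          have h2 : x = tensorPerm K n _ σ (tensorPerm K n _ σ⁻¹ x) := by
            rw [← Module.End.mul_apply, ← map_mul, mul_inv_cancel, map_one, Module.End.one_apply]
          conv_lhs => rw [h2]
          rw [← tensorPerm_tensorEval, tensorEval_smulRight, map_smul]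
      | hs r w hw =>
        obtain ⟨f, hf⟩ := hw
        refine ⟨r • f, fun x => ?_⟩
        rw [Submodule.coe_smul, map_smul, LinearMap.smul_apply, hf, Finset.smul_sum]
        exact Finset.sum_congr rfl fun σ _ => by rw [map_smul, smul_comm]
      | ha w w' hw hw' =>
        obtain ⟨f, hf⟩ := hw
        obtain ⟨f', hf'⟩ := hw'
        refine ⟨f + f', fun x => ?_⟩
        rw [Submodule.coe_add, map_add, LinearMap.add_apply, hf, hf', ← Finset.sum_add_distrib]
        exact Finset.sum_congr rfl fun σ _ => by rw [map_add, smul_add]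
    | hs r η hη =>
      obtain ⟨f, hf⟩ := hη
      refine ⟨r • f, fun x => ?_⟩
      rw [Submodule.coe_smul, map_smul, LinearMap.smul_apply, hf, Finset.smul_sum]
      exact Finset.sum_congr rfl fun σ _ => by rw [map_smul, LinearMap.smul_apply, smul_assoc]
    | ha η η' hη hη' =>
      obtain ⟨f, hf⟩ := hη
      obtain ⟨f', hf'⟩ := hη'
      refine ⟨f + f', fun x => ?_⟩
      rw [Submodule.coe_add, map_add, LinearMap.add_apply, hf, hf', ← Finset.sum_add_distrib]
      exact Finset.sum_congr rfl fun σ _ => by rw [map_add, LinearMap.add_apply, add_smul]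
  -- As `U` is finite dimensional, `dualDistrib` is onto the forms on `U^{⊗ n}`, so `ξ` may be taken
  -- to come from a tensor of forms.
  have h := LinearMap.congr_fun
    (PiTensorProduct.dualDistrib_dualDistribInvOfBasis_left_inverse
      (fun _ : Fin n => Module.finBasis K U)) ξ
  rw [← show _ = ξ from h]
  exact key _ v

/-- A composite `V^{⊗ n} → K[𝔖ₙ] → W^{⊗ n}` comes from a morphism of `Γⁿ𝒱`. -/
theorem exists_iFun_map {X Z : GammaCat K n} (a : (iFun K n).obj X ⟶ regRep K (SymGrp n))
    (b : regRep K (SymGrp n) ⟶ (iFun K n).obj Z) :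
    ∃ f : X ⟶ Z, (iFun K n).map f = a ≫ b := by
  obtain ⟨ξ, rfl⟩ : ∃ ξ, toReg _ ξ = a := ⟨_, toReg_coeffOne a⟩
  obtain ⟨v, rfl⟩ : ∃ v, fromReg _ v = b := ⟨_, fromReg_linOf b⟩
  obtain ⟨f, hf⟩ := exists_tensorEval_eq_sum (U := X.V) (W := Z.V) ξ v
  exact ⟨f, fdRep_hom_ext fun x => (hf x).trans (toReg_comp_fromReg ξ v x).symm⟩

/-- The inclusion of the regular representation into `(Kⁿ)^{⊗ n}` with `1 ↦ e₁ ⊗ ⋯ ⊗ eₙ`. -/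
def regIncl : regRep K (SymGrp n) ⟶ (iFun K n).obj stdObj :=
  fromReg _ (PiTensorProduct.tprod K fun i : Fin n => (Pi.single i (1 : K) : Fin n → K))

/-- The projection of `(Kⁿ)^{⊗ n}` onto the regular representation, given by the form
`e₁^* ⊗ ⋯ ⊗ eₙ^*`. -/
def regProj : (iFun K n).obj stdObj ⟶ regRep K (SymGrp n) :=
  toReg _ (PiTensorProduct.dualDistrib
    (PiTensorProduct.tprod K fun i : Fin n => (LinearMap.proj i : (Fin n → K) →ₗ[K] K)))

/-- The form takes the value `∏ δ_{i, σ⁻¹ i}` on `σ (e₁ ⊗ ⋯ ⊗ eₙ)`, which vanishes unless `σ = 1`.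
The `n` distinct basis vectors are the reason for working with `Kⁿ`. -/
theorem regIncl_regProj : regIncl ≫ regProj = 𝟙 (regRep K (SymGrp n)) := by
  refine fromReg_comp_toReg fun σ => ?_
  have h1 : ((iFun K n).obj stdObj).ρ σ
      (PiTensorProduct.tprod K fun i : Fin n => (Pi.single i (1 : K) : Fin n → K)) =
      PiTensorProduct.tprod K fun i : Fin n => (Pi.single (σ.symm i) (1 : K) : Fin n → K) :=
    tensorPerm_tprod K n (V := Fin n → K) σ _
  rw [h1]
  refine (PiTensorProduct.dualDistrib_apply _ _).trans ?_
  by_cases h : σ = 1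
  · subst h
    rw [coeffOne_regElt_one]
    exact Finset.prod_eq_one fun i _ => Pi.single_eq_same _ _
  · obtain ⟨i, hi⟩ : ∃ i, σ.symm i ≠ i := by
      by_contra! hc
      exact h (Equiv.ext fun i => by rw [← hc (σ i), Equiv.symm_apply_apply]; rfl)
    rw [coeffOne_regElt_ne h]
    exact Finset.prod_eq_zero (Finset.mem_univ i) (Pi.single_eq_of_ne hi.symm _)

/-! ### Evaluation at the regular representation -/

variable {f g h : ACat K (SymGrp n)}

/-- The component of a morphism `j^*(f) ⟶ j^*(g)`, as a map `f(V^{⊗ n}) → g(V^{⊗ n})`. -/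
def jApp (φ : (jUpA K n).obj f ⟶ (jUpA K n).obj g) (X : GammaCat K n) :
    f.obj.obj ((iFun K n).obj X) ⟶ g.obj.obj ((iFun K n).obj X) := φ.hom.app X

theorem jApp_map (α : f ⟶ g) (X : GammaCat K n) :
    jApp ((jUpA K n).map α) X = α.hom.app ((iFun K n).obj X) := rfl

theorem jApp_comp (φ : (jUpA K n).obj f ⟶ (jUpA K n).obj g)
    (ψ : (jUpA K n).obj g ⟶ (jUpA K n).obj h) (X : GammaCat K n) :
    jApp (φ ≫ ψ) X = jApp φ X ≫ jApp ψ X := rfl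

theorem jApp_ext {φ ψ : (jUpA K n).obj f ⟶ (jUpA K n).obj g} (e : ∀ X, jApp φ X = jApp ψ X) :
    φ = ψ :=
  ObjectProperty.hom_ext _ (NatTrans.ext (funext e))

theorem jApp_naturality (φ : (jUpA K n).obj f ⟶ (jUpA K n).obj g) {X Z : GammaCat K n}
    {a : (iFun K n).obj X ⟶ (iFun K n).obj Z} (ha : ∃ b, (iFun K n).map b = a) :
    f.obj.map a ≫ jApp φ Z = jApp φ X ≫ g.obj.map a := by
  obtain ⟨b, rfl⟩ := ha
  exact φ.hom.naturality b

/-- A morphism `j^*(f) ⟶ j^*(g)` induces a map `f(K[𝔖ₙ]) → g(K[𝔖ₙ])`, since the regular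
representation is a direct summand of `(Kⁿ)^{⊗ n}`. -/
def evalReg (φ : (jUpA K n).obj f ⟶ (jUpA K n).obj g) :
    f.obj.obj (regRep K (SymGrp n)) ⟶ g.obj.obj (regRep K (SymGrp n)) :=
  f.obj.map regIncl ≫ jApp φ stdObj ≫ g.obj.map regProj

/-- The map `a` itself is not between objects of the form `V^{⊗ n}`, but `regProj ≫ a` is, and it
comes from `Γⁿ𝒱` because it factors through `K[𝔖ₙ]`. Naturality for it suffices, since `regIncl ≫
regProj` is the identity. -/
theorem evalReg_comp_map (φ : (jUpA K n).obj f ⟶ (jUpA K n).obj g) {X : GammaCat K n}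
    (a : regRep K (SymGrp n) ⟶ (iFun K n).obj X) :
    evalReg φ ≫ g.obj.map a = f.obj.map a ≫ jApp φ X := by
  have h := jApp_naturality φ (exists_iFun_map regProj a)
  calc evalReg φ ≫ g.obj.map a
      = f.obj.map regIncl ≫ jApp φ stdObj ≫ g.obj.map (regProj ≫ a) := by
        rw [evalReg, Category.assoc, Category.assoc, Functor.map_comp]
    _ = f.obj.map regIncl ≫ f.obj.map (regProj ≫ a) ≫ jApp φ X := by rw [h]
    _ = f.obj.map a ≫ jApp φ X := by
        rw [← Functor.map_comp_assoc, ← Category.assoc regIncl, regIncl_regProj, Category.id_comp]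

/-- The mirror image of `evalReg_comp_map`, with `a ≫ regIncl` as the morphism that comes from
`Γⁿ𝒱`. -/
theorem map_comp_evalReg (φ : (jUpA K n).obj f ⟶ (jUpA K n).obj g) {X : GammaCat K n}
    (a : (iFun K n).obj X ⟶ regRep K (SymGrp n)) :
    f.obj.map a ≫ evalReg φ = jApp φ X ≫ g.obj.map a := by
  have h := jApp_naturality φ (exists_iFun_map a regIncl)
  calc f.obj.map a ≫ evalReg φ
      = (f.obj.map (a ≫ regIncl) ≫ jApp φ stdObj) ≫ g.obj.map regProj := by
        rw [evalReg, Functor.map_comp, Category.assoc, Category.assoc]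
    _ = jApp φ X ≫ g.obj.map (a ≫ regIncl) ≫ g.obj.map regProj := by rw [h, Category.assoc]
    _ = jApp φ X ≫ g.obj.map a := by
        rw [← Functor.map_comp, Category.assoc, regIncl_regProj, Category.comp_id]

theorem evalReg_naturality (φ : (jUpA K n).obj f ⟶ (jUpA K n).obj g)
    (a : regRep K (SymGrp n) ⟶ regRep K (SymGrp n)) :
    f.obj.map a ≫ evalReg φ = evalReg φ ≫ g.obj.map a := by
  calc f.obj.map a ≫ evalReg φ
      = (f.obj.map (a ≫ regIncl) ≫ jApp φ stdObj) ≫ g.obj.map regProj := by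
        rw [evalReg, Functor.map_comp, Category.assoc, Category.assoc]
    _ = (evalReg φ ≫ g.obj.map (a ≫ regIncl)) ≫ g.obj.map regProj := by rw [evalReg_comp_map]
    _ = evalReg φ ≫ g.obj.map a := by
        rw [Category.assoc, ← Functor.map_comp, Category.assoc, regIncl_regProj, Category.comp_id]

theorem evalReg_map (α : f ⟶ g) :
    evalReg ((jUpA K n).map α) = α.hom.app (regRep K (SymGrp n)) := by
  rw [evalReg, jApp_map, ← α.hom.naturality, ← Functor.map_comp_assoc, regIncl_regProj,
    CategoryTheory.Functor.map_id, Category.id_comp]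

theorem evalReg_comp_jUpA_map (φ : (jUpA K n).obj f ⟶ (jUpA K n).obj g) (α : g ⟶ h) :
    evalReg (φ ≫ (jUpA K n).map α) = evalReg φ ≫ α.hom.app (regRep K (SymGrp n)) := by
  rw [evalReg, jApp_comp, jApp_map, evalReg, Category.assoc, Category.assoc, Category.assoc,
    α.hom.naturality]

theorem evalReg_jUpA_map_comp (α : f ⟶ g) (φ : (jUpA K n).obj g ⟶ (jUpA K n).obj h) :
    evalReg ((jUpA K n).map α ≫ φ) = α.hom.app (regRep K (SymGrp n)) ≫ evalReg φ := by
  rw [evalReg, jApp_comp, jApp_map, evalReg, Category.assoc, ← α.hom.naturality_assoc]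

end TensorPowers

/-! ### The functors `𝐭_M` and their value at the regular representation -/

section Coinvariants

variable {K : Type u} [Field K] {G : Type} [Group G]

/-- The linear map underlying the action of a functor on a morphism. -/
abbrev mapLin (f : ACat K G) {X Z : FDRep K G} (a : X ⟶ Z) : f.obj.obj X →ₗ[K] f.obj.obj Z :=
  (f.obj.map a).hom.hom

theorem mapLin_id (f : ACat K G) {X : FDRep K G} (x : f.obj.obj X) : mapLin f (𝟙 X) x = x := by
  rw [mapLin, CategoryTheory.Functor.map_id]
  rfl

theorem mapLin_comp (f : ACat K G) {X Y Z : FDRep K G} (a : X ⟶ Y) (b : Y ⟶ Z)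
    (x : f.obj.obj X) : mapLin f (a ≫ b) x = mapLin f b (mapLin f a x) := by
  rw [mapLin, Functor.map_comp]
  rfl

/-- The class of `m ⊗ x` in `𝐭_M(X)`. -/
def tMk (M X : FDRep K G) : M →ₗ[K] X →ₗ[K] ((tFun K G).obj M).obj.obj X :=
  (TensorProduct.mk K M X).compr₂ (Representation.Coinvariants.mk (M ⊗ X).ρ)

theorem tMk_rho (M X : FDRep K G) (g : G) (m : M) (x : X) :
    tMk M X (M.ρ g m) (X.ρ g x) = tMk M X m x :=
  Representation.Coinvariants.mk_self_apply (M ⊗ X).ρ g (m ⊗ₜ[K] x)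

theorem tMk_rho_left (M X : FDRep K G) (g : G) (m : M) (x : X) :
    tMk M X (M.ρ g m) x = tMk M X m (X.ρ g⁻¹ x) := by
  rw [← tMk_rho M X g m (X.ρ g⁻¹ x), ← Module.End.mul_apply, ← map_mul, mul_inv_cancel, map_one,
    Module.End.one_apply]

theorem mapLin_tMk (M : FDRep K G) {X Z : FDRep K G} (a : X ⟶ Z) (m : M) (x : X) :
    mapLin ((tFun K G).obj M) a (tMk M X m x) = tMk M Z m (linOf a x) := rfl

theorem tMk_ext {M X : FDRep K G} {P : Type*} [AddCommGroup P] [Module K P]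
    {a b : ((tFun K G).obj M).obj.obj X →ₗ[K] P}
    (h : ∀ m x, a (tMk M X m x) = b (tMk M X m x)) : a = b :=
  Representation.Coinvariants.hom_ext (TensorProduct.ext' h)

theorem tMk_hom_ext {M X : FDRep K G} {P : FGModuleCat.{u} K}
    {a b : ((tFun K G).obj M).obj.obj X ⟶ P}
    (h : ∀ m x, a.hom.hom (tMk M X m x) = b.hom.hom (tMk M X m x)) : a = b :=
  FGModuleCat.hom_ext (tMk_ext h)

/-- The linear map on `𝐭_M(X)` given by an invariant bilinear map on `M × X`. -/
def tLift {M X : FDRep K G} {P : Type*} [AddCommGroup P] [Module K P] (B : M →ₗ[K] X →ₗ[K] P)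
    (hB : ∀ g m x, B (M.ρ g m) (X.ρ g x) = B m x) : ((tFun K G).obj M).obj.obj X →ₗ[K] P :=
  Representation.Coinvariants.lift (M ⊗ X).ρ (TensorProduct.lift B) fun g =>
    TensorProduct.ext' (hB g)

theorem tLift_tMk {M X : FDRep K G} {P : Type*} [AddCommGroup P] [Module K P]
    (B : M →ₗ[K] X →ₗ[K] P) (hB : ∀ g m x, B (M.ρ g m) (X.ρ g x) = B m x) (m : M) (x : X) :
    tLift B hB (tMk M X m x) = B m x := rfl

section Finite

variable [Finite G]

/-- The isomorphism `𝐭_M(K[G]) → M`, `m ⊗ g ↦ g⁻¹ m`. -/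
def tReg (M : FDRep K G) : ((tFun K G).obj M).obj.obj (regRep K G) →ₗ[K] M :=
  letI := Fintype.ofFinite G
  -- On `m ⊗ h` only the summand with `g h = 1` survives, which gives `h⁻¹ m`. Summing over all `g`
  -- makes the invariance a mere reindexing.
  tLift (∑ g : G, (LinearMap.lsmul K M).flip.compl₁₂ (M.ρ g) (coeffOne ∘ₗ (regRep K G).ρ g))
    fun h m x => by
      rw [LinearMap.sum_apply, LinearMap.sum_apply, LinearMap.sum_apply, LinearMap.sum_apply]
      refine Fintype.sum_equiv (Equiv.mulRight h) _ _ fun g => ?_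
      simp only [LinearMap.compl₁₂_apply, LinearMap.comp_apply, Equiv.coe_mulRight, map_mul,
        Module.End.mul_apply]

theorem tReg_tMk_one {M : FDRep K G} (m : M) : tReg M (tMk M _ m (regElt 1)) = m := by
  let _ := Fintype.ofFinite G
  refine (tLift_tMk _ _ m _).trans ?_
  rw [LinearMap.sum_apply, LinearMap.sum_apply, Finset.sum_eq_single 1]
  · change coeffOne ((regRep K G).ρ 1 (regElt 1)) • M.ρ 1 m = m
    rw [rho_regElt, mul_one, coeffOne_regElt_one, map_one, one_smul, Module.End.one_apply]
  · intro g _ hg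
    change coeffOne ((regRep K G).ρ g (regElt 1)) • M.ρ g m = 0
    rw [rho_regElt, mul_one, coeffOne_regElt_ne hg, zero_smul]
  · exact fun h => absurd (Finset.mem_univ _) h

theorem tMk_regElt {M : FDRep K G} (m : M) (g : G) :
    tMk M (regRep K G) m (regElt g) = tMk M _ (M.ρ g⁻¹ m) (regElt 1) := by
  rw [tMk_rho_left, inv_inv, rho_regElt, mul_one]

/-- Moving group elements across the tensor sign brings every `m ⊗ g` to the form `m' ⊗ 1`. -/
theorem tMk_tReg {M : FDRep K G} (z : ((tFun K G).obj M).obj.obj (regRep K G)) :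
    tMk M _ (tReg M z) (regElt 1) = z := by
  refine LinearMap.congr_fun (f := (tMk M (regRep K G)).flip (regElt 1) ∘ₗ tReg M)
    (g := LinearMap.id) (tMk_ext fun m x => ?_) z
  refine LinearMap.congr_fun (f := ((tMk M (regRep K G)).flip (regElt 1) ∘ₗ tReg M) ∘ₗ
    tMk M (regRep K G) m) (g := tMk M (regRep K G) m) (regElt_induction fun g => ?_) x
  change tMk M _ (tReg M (tMk M _ m (regElt g))) (regElt 1) = tMk M _ m (regElt g)
  rw [tMk_regElt m g, tReg_tMk_one]

end Finite

end Coinvariants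

/-! ### Full faithfulness of `c_!` -/

section FullyFaithful

variable {K : Type u} [Field K] {n : ℕ}

theorem jApp_mapLin {f g : ACat K (SymGrp n)} (φ : (jUpA K n).obj f ⟶ (jUpA K n).obj g)
    {X : GammaCat K n} (a : regRep K (SymGrp n) ⟶ (iFun K n).obj X) (x : f.obj.obj (regRep K _)) :
    (jApp φ X).hom.hom (mapLin f a x) = mapLin g a ((evalReg φ).hom.hom x) :=
  (LinearMap.congr_fun (congrArg (fun α => α.hom.hom) (evalReg_comp_map φ a)) x).symm

theorem mapLin_jApp {f g : ACat K (SymGrp n)} (φ : (jUpA K n).obj f ⟶ (jUpA K n).obj g)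
    {X : GammaCat K n} (a : (iFun K n).obj X ⟶ regRep K (SymGrp n))
    (x : f.obj.obj ((iFun K n).obj X)) :
    mapLin g a ((jApp φ X).hom.hom x) = (evalReg φ).hom.hom (mapLin f a x) :=
  (LinearMap.congr_fun (congrArg (fun α => α.hom.hom) (map_comp_evalReg φ a)) x).symm

theorem evalReg_mapLin {f g : ACat K (SymGrp n)} (φ : (jUpA K n).obj f ⟶ (jUpA K n).obj g)
    (a : regRep K (SymGrp n) ⟶ regRep K (SymGrp n)) (x : f.obj.obj (regRep K _)) :
    (evalReg φ).hom.hom (mapLin f a x) = mapLin g a ((evalReg φ).hom.hom x) :=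
  LinearMap.congr_fun (congrArg (fun α => α.hom.hom) (evalReg_naturality φ a)) x

theorem jApp_ext_apply {f g : ACat K (SymGrp n)} {φ ψ : (jUpA K n).obj f ⟶ (jUpA K n).obj g}
    (e : ∀ X x, (jApp φ X).hom.hom x = (jApp ψ X).hom.hom x) : φ = ψ :=
  jApp_ext fun X => FGModuleCat.hom_ext (LinearMap.ext (e X))

/-- The morphism of representations `M ⟶ L` induced by a morphism `c_!(M) ⟶ c_!(L)`. -/
def cShriekPreimage {M L : FDRep K (SymGrp n)} (φ : (jUpA K n).obj ((tFun K _).obj M) ⟶ (jUpA K n).obj ((tFun K _).obj L)) :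
    M ⟶ L :=
  homOfLin (tReg L ∘ₗ (evalReg φ).hom.hom ∘ₗ
    (tMk M (regRep K _)).flip (regElt 1)) fun σ m => by
    let y := (evalReg φ).hom.hom
      (tMk M (regRep K _) m (regElt 1))
    -- Under `m ↦ m ⊗ 1` the action of `σ` on `M` becomes right multiplication by `σ⁻¹` on `K[𝔖ₙ]`,
    -- an endomorphism with which `evalReg φ` commutes.
    have h1 : tMk M (regRep K (SymGrp n)) (M.ρ σ m) (regElt 1) =
        mapLin ((tFun K _).obj M) (regRight K _ σ) (tMk M _ m (regElt 1)) := by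
      rw [mapLin_tMk, linOf_regRight, tMk_regElt _ σ⁻¹, inv_inv]
    have h2 : mapLin ((tFun K _).obj L) (regRight K _ σ) y =
        tMk L _ (L.ρ σ (tReg L y)) (regElt 1) := by
      rw [← tMk_tReg y, mapLin_tMk, linOf_regRight, tMk_regElt _ σ⁻¹, inv_inv, tReg_tMk_one]
    change tReg L ((evalReg φ).hom.hom
      (tMk M (regRep K _) (M.ρ σ m) (regElt 1))) = L.ρ σ (tReg L y)
    rw [h1, evalReg_mapLin, h2, tReg_tMk_one]

theorem cShriekPreimage_apply {M L : FDRep K (SymGrp n)}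
    (φ : (jUpA K n).obj ((tFun K _).obj M) ⟶ (jUpA K n).obj ((tFun K _).obj L)) (m : M) :
    linOf (cShriekPreimage φ) m = tReg L ((evalReg φ).hom.hom (tMk M (regRep K _) m (regElt 1))) := rfl

/-- The class of `m ⊗ x` is the image of `m ⊗ 1` under the morphism `K[𝔖ₙ] → V^{⊗ n}` with `1 ↦ x`,
so `φ` is determined by its effect on `𝐭_M(K[𝔖ₙ])`. -/
theorem cShriek_map_preimage {M L : FDRep K (SymGrp n)}
    (φ : (jUpA K n).obj ((tFun K _).obj M) ⟶ (jUpA K n).obj ((tFun K _).obj L)) :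
    (jUpA K n).map ((tFun K _).map (cShriekPreimage φ)) = φ := by
  refine jApp_ext fun X => tMk_hom_ext fun m x => ?_
  have h := jApp_mapLin φ
    (fromReg ((iFun K n).obj X) x) (tMk M _ m (regElt 1))
  rw [mapLin_tMk, fromReg_one] at h
  rw [h, ← tMk_tReg ((evalReg φ).hom.hom
    (tMk M (regRep K _) m (regElt 1))), mapLin_tMk, fromReg_one]
  rfl

theorem cShriekPreimage_map {M L : FDRep K (SymGrp n)} (a : M ⟶ L) :
    cShriekPreimage ((jUpA K n).map ((tFun K _).map a)) = a := by
  refine fdRep_hom_ext fun m => ?_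
  have h := evalReg_map ((tFun K (SymGrp n)).map a)
  rw [cShriekPreimage_apply]
  refine (congrArg (fun β => tReg L (β.hom.hom (tMk M (regRep K _) m (regElt 1)))) h).trans ?_
  change tReg L (tMk L _ (linOf a m) (regElt 1)) = _
  rw [tReg_tMk_one]

end FullyFaithful

/-! ### Full faithfulness of `M ↦ j^*(𝐡_M)` -/

section HPow

variable {K : Type u} [Field K] {n : ℕ}

/-- Evaluation on the regular representation of a morphism `j^*(𝐡_N) ⟶ j^*(𝐡_L)`. -/
def hEvalReg {N L : FDRep K (SymGrp n)}
    (φ : (jUpA K n).obj ((hG K _).obj (op N)) ⟶ (jUpA K n).obj ((hG K _).obj (op L))) :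
    (N ⟶ regRep K (SymGrp n)) →ₗ[K] (L ⟶ regRep K (SymGrp n)) :=
  (evalReg φ).hom.hom

theorem hEvalReg_comp {N L : FDRep K (SymGrp n)}
    (φ : (jUpA K n).obj ((hG K _).obj (op N)) ⟶ (jUpA K n).obj ((hG K _).obj (op L)))
    (a : N ⟶ regRep K (SymGrp n)) (c : regRep K (SymGrp n) ⟶ regRep K (SymGrp n)) :
    hEvalReg φ (a ≫ c) = hEvalReg φ a ≫ c :=
  evalReg_mapLin φ c a

theorem separating {V : Type*} [AddCommGroup V] [Module K V] {v w : V}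
    (h : ∀ ξ : V →ₗ[K] K, ξ v = ξ w) : v = w :=
  sub_eq_zero.1 ((Module.forall_dual_apply_eq_zero_iff K _).1 fun ξ => by
    rw [map_sub, h, sub_self])

/-- The linear map `L → N` which is induced by a morphism `j^*(𝐡_N) ⟶ j^*(𝐡_L)`. -/
def hPreimageLin {N L : FDRep K (SymGrp n)}
    (φ : (jUpA K n).obj ((hG K _).obj (op N)) ⟶ (jUpA K n).obj ((hG K _).obj (op L))) :
    L →ₗ[K] N :=
  (Module.evalEquiv K N).symm.toLinearMap ∘ₗ LinearMap.flip
    ((LinearMap.compRight K coeffOne) ∘ₗ linOfₗ L (regRep K (SymGrp n)) ∘ₗ hEvalReg φ ∘ₗ toRegₗ N)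

/-- With `Hom(N, K[𝔖ₙ]) = N^*` and likewise for `L`, `hEvalReg φ` is a map `N^* → L^*`. The map `L →
N` is its transpose, through `N = N^{**}`, and this formula characterizes it. -/
theorem form_hPreimageLin {N L : FDRep K (SymGrp n)}
    (φ : (jUpA K n).obj ((hG K _).obj (op N)) ⟶ (jUpA K n).obj ((hG K _).obj (op L)))
    (ξ : N →ₗ[K] K) (l : L) :
    ξ (hPreimageLin φ l) = coeffOne (linOf (hEvalReg φ (toReg N ξ)) l) :=
  Module.apply_evalEquiv_symm_apply K N ξ _

/-- The morphism of representations `L ⟶ N` induced by a morphism `j^*(𝐡_N) ⟶ j^*(𝐡_L)`. -/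
def hPreimage {N L : FDRep K (SymGrp n)}
    (φ : (jUpA K n).obj ((hG K _).obj (op N)) ⟶ (jUpA K n).obj ((hG K _).obj (op L))) :
    L ⟶ N :=
  homOfLin (hPreimageLin φ) fun σ l => separating fun ξ => by
    -- This is right multiplication by `σ`; composing with it twists the form of a morphism to
    -- `K[𝔖ₙ]` by `σ`.
    let c : regRep K (SymGrp n) ⟶ regRep K (SymGrp n) :=
      toReg _ (coeffOne ∘ₗ (regRep K (SymGrp n)).ρ σ)
    have hc : toReg N (ξ ∘ₗ N.ρ σ) = toReg N ξ ≫ c := by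
      rw [comp_toReg]
      congr 1
      ext x
      change ξ (N.ρ σ x) = coeffOne ((regRep K (SymGrp n)).ρ σ (linOf (toReg N ξ) x))
      rw [← linOf_comm, coeffOne_toReg]
    have h : ξ (N.ρ σ (hPreimageLin φ l)) = _ := form_hPreimageLin φ (ξ ∘ₗ N.ρ σ) l
    rw [form_hPreimageLin, h, hc, hEvalReg_comp, linOf_comm, linOf_comp, coeffOne_toReg]
    rfl

theorem form_hPreimage {N L : FDRep K (SymGrp n)}
    (φ : (jUpA K n).obj ((hG K _).obj (op N)) ⟶ (jUpA K n).obj ((hG K _).obj (op L)))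
    (ξ : N →ₗ[K] K) (l : L) :
    ξ (linOf (hPreimage φ) l) = coeffOne (linOf (hEvalReg φ (toReg N ξ)) l) :=
  form_hPreimageLin φ ξ l

/-- Morphisms into `V^{⊗ n}` are separated by their composites with the `toReg η`. These composites
end in `K[𝔖ₙ]`, where `φ` acts through `hEvalReg φ`. -/
theorem hG_map_preimage {N L : FDRep K (SymGrp n)}
    (φ : (jUpA K n).obj ((hG K _).obj (op N)) ⟶ (jUpA K n).obj ((hG K _).obj (op L))) :
    (jUpA K n).map ((hG K _).map (hPreimage φ).op) = φ := by
  refine jApp_ext_apply fun X (θ : N ⟶ (iFun K n).obj X) => ?_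
  change hPreimage φ ≫ θ = (show L ⟶ (iFun K n).obj X from (jApp φ X).hom.hom θ)
  refine fdRep_hom_ext fun l => separating (K := K) fun η => ?_
  have h : (show L ⟶ (iFun K n).obj X from (jApp φ X).hom.hom θ) ≫ toReg _ η =
      hEvalReg φ (θ ≫ toReg _ η) := mapLin_jApp φ (toReg _ η) θ
  rw [← coeffOne_toReg η (linOf (show L ⟶ (iFun K n).obj X from (jApp φ X).hom.hom θ) l),
    ← linOf_comp, h, comp_toReg, ← form_hPreimage]
  rfl

theorem hPreimage_map {N L : FDRep K (SymGrp n)} (a : L ⟶ N) :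
    hPreimage ((jUpA K n).map ((hG K _).map a.op)) = a := by
  refine fdRep_hom_ext fun l => separating (K := K) fun ξ => ?_
  have h : hEvalReg ((jUpA K n).map ((hG K _).map a.op)) (toReg N ξ) = a ≫ toReg N ξ :=
    congrArg (fun β => β.hom.hom (toReg N ξ)) (evalReg_map ((hG K (SymGrp n)).map a.op))
  rw [form_hPreimage, h, linOf_comp, coeffOne_toReg]

end HPow

/-! ### The middle diagram: `c^* ∘ j^* = t^*` and the kernel categories -/

section Middle

variable {K : Type u} [Field K]

/-- `mapLin` as a linear map. -/
def mapLinₗ {G : Type} [Group G] (f : ACat K G) (X Z : FDRep K G) :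
    (X ⟶ Z) →ₗ[K] f.obj.obj X →ₗ[K] f.obj.obj Z where
  toFun a := mapLin f a
  map_add' a b := by rw [mapLin, Functor.map_add]; rfl
  map_smul' r a := by rw [mapLin, Functor.map_smul]; rfl

/-- The isomorphism of representations given by an equivariant linear equivalence. -/
def isoOfLin {G : Type} [Group G] {M N : FDRep K G} (e : M ≃ₗ[K] N)
    (h : ∀ g x, e (M.ρ g x) = N.ρ g (e x)) : M ≅ N :=
  Action.mkIso (e.toFGModuleCatIso) fun g => FGModuleCat.hom_ext (LinearMap.ext (h g))

variable {n : ℕ}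

/-- The forgetful functor, as an object of `𝒜(G)`. -/
def forgetA (K : Type u) [Field K] (G : Type) [Group G] : ACat K G :=
  ⟨Action.forget _ _, inferInstance, inferInstance⟩

theorem evalReg_add {f g : ACat K (SymGrp n)} (φ ψ : (jUpA K n).obj f ⟶ (jUpA K n).obj g) :
    evalReg (φ + ψ) = evalReg φ + evalReg ψ := by
  have h : jApp (φ + ψ) stdObj = jApp φ stdObj + jApp ψ stdObj := rfl
  rw [evalReg, h, Preadditive.add_comp, Preadditive.comp_add]
  rfl

theorem evalReg_smul {f g : ACat K (SymGrp n)} (r : K)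
    (φ : (jUpA K n).obj f ⟶ (jUpA K n).obj g) : evalReg (r • φ) = r • evalReg φ := by
  have h : jApp (r • φ) stdObj = r • jApp φ stdObj := rfl
  rw [evalReg, h, Linear.smul_comp, Linear.comp_smul]
  rfl

/-- `Hom(Tⁿ, j^*(f)) = f(K[𝔖ₙ])`. -/
def tensorPowHomEquiv (f : ACat K (SymGrp n)) :
    ((jUpA K n).obj (forgetA K _) ⟶ (jUpA K n).obj f) ≃ₗ[K] f.obj.obj (regRep K (SymGrp n)) where
  toFun φ := (evalReg φ).hom.hom (regElt 1)
  map_add' φ ψ := by rw [evalReg_add]; rfl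
  map_smul' r φ := by rw [evalReg_smul]; rfl
  -- The Yoneda map for the forgetful functor, which is represented by `K[𝔖ₙ]`: a vector `v` goes to
  -- the image of `x` under `f` of the morphism with `1 ↦ v`.
  invFun x := ObjectProperty.homMk
    { app := fun X => FGModuleCat.ofHom
        ((mapLinₗ f (regRep K _) ((iFun K n).obj X) ∘ₗ fromRegₗ ((iFun K n).obj X)).flip x)
      naturality := fun X Z b => FGModuleCat.hom_ext (LinearMap.ext
        fun (v : (iFun K n).obj X) => by
          change mapLin f (fromReg ((iFun K n).obj Z) (linOf ((iFun K n).map b) v)) x =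
            mapLin f ((iFun K n).map b) (mapLin f (fromReg ((iFun K n).obj X) v) x)
          rw [← mapLin_comp, fromReg_comp]) }
  left_inv φ := jApp_ext_apply (f := forgetA K _) fun X v => by
    have h := jApp_mapLin (f := forgetA K _) φ (fromReg ((iFun K n).obj X) v) (regElt 1)
    refine h.symm.trans (congrArg (fun w => (jApp (f := forgetA K _) φ X).hom.hom w) ?_)
    exact fromReg_one v
  right_inv x := by
    change mapLin f regProj (mapLin f (fromReg _ (linOf regIncl (regElt 1))) x) = x
    rw [fromReg_linOf, ← mapLin_comp, regIncl_regProj, mapLin_id]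

/-- The action of a group element as an endomorphism of the forgetful functor. -/
def forgetPerm {G : Type} [Group G] (g : G) : forgetA K G ⟶ forgetA K G :=
  ObjectProperty.homMk
    { app := fun X => Action.ρ X g
      naturality := fun _ _ f => (f.comm g).symm }

/-- Left and right multiplication by `σ⁻¹` agree on the neutral element, and `evalReg φ` commutes
with right multiplications. -/
theorem tensorPowHomEquiv_perm (f : ACat K (SymGrp n)) (σ : SymGrp n)
    (φ : (jUpA K n).obj (forgetA K _) ⟶ (jUpA K n).obj f) :
    tensorPowHomEquiv f ((jUpA K n).map (forgetPerm σ⁻¹) ≫ φ) =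
      mapLin f (regRight K _ σ) (tensorPowHomEquiv f φ) := by
  have h := evalReg_mapLin φ (regRight K _ σ) (regElt (K := K) (1 : SymGrp n))
  refine Eq.trans ?_ h
  change (evalReg ((jUpA K n).map (forgetPerm σ⁻¹) ≫ φ)).hom.hom (regElt 1) = _
  rw [evalReg_jUpA_map_comp]
  change (evalReg φ).hom.hom ((regRep K (SymGrp n)).ρ σ⁻¹ (regElt 1)) =
    (evalReg φ).hom.hom (linOf (regRight K _ σ) (regElt 1))
  rw [rho_regElt, mul_one, linOf_regRight]

theorem tensorPowHomEquiv_comp {f g : ACat K (SymGrp n)} (α : f ⟶ g)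
    (φ : (jUpA K n).obj (forgetA K _) ⟶ (jUpA K n).obj f) :
    tensorPowHomEquiv g (φ ≫ (jUpA K n).map α) =
      (α.hom.app (regRep K _)).hom.hom (tensorPowHomEquiv f φ) := by
  change (evalReg (φ ≫ (jUpA K n).map α)).hom.hom (regElt 1) = _
  rw [evalReg_comp_jUpA_map]
  rfl

/-- `c^* ∘ j^* = t^*`. -/
def jUpCUpIso : jUp K n ⋙ cUp K n ≅ tUp K (SymGrp n) :=
  NatIso.ofComponents
    (fun f => isoOfLin (M := (jUp K n ⋙ cUp K n).obj f) (N := (tUp K (SymGrp n)).obj f)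
      ((Shrink.linearEquiv K (tensorPow K n ⟶ (jUpA K n).obj f.obj)).trans
        (tensorPowHomEquiv f.obj)) fun σ φ => by
      change tensorPowHomEquiv f.obj (Shrink.linearEquiv K _ ((Shrink.linearEquiv K _).symm
        ((jUpA K n).map (forgetPerm σ⁻¹) ≫ Shrink.linearEquiv K _ φ))) = _
      rw [LinearEquiv.apply_symm_apply]
      exact tensorPowHomEquiv_perm f.obj σ _)
    fun {f g} α => fdRep_hom_ext fun φ => by
      change tensorPowHomEquiv g.obj (Shrink.linearEquiv K _ ((Shrink.linearEquiv K _).symm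
        (Shrink.linearEquiv K (tensorPow K n ⟶ (jUpA K n).obj f.obj) φ ≫
          (jUpA K n).map α.hom))) = _
      rw [LinearEquiv.apply_symm_apply]
      exact tensorPowHomEquiv_comp α.hom _

theorem isP0_jUp {f : CCat K (SymGrp n)} (hf : isC0 K (SymGrp n) f) : isP0 K n ((jUp K n).obj f) :=
  hf.of_iso (jUpCUpIso.app f)

/-- In a block of length one the element is the left end of the block, so the block determines it.
-/
theorem partComposition_index_injective (lam : n.Partition) (h : ∀ i ∈ lam.parts, i = 1) :
    Function.Injective (partComposition lam).index := by
  intro i j hij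
  have h1 : ∀ k, (partComposition lam).blocksFun k = 1 := fun k =>
    h _ ((Multiset.mem_sort _).1 (List.getElem_mem k.2))
  have h2 : ∀ k : Fin n, (k : ℕ) = (partComposition lam).sizeUpTo ((partComposition lam).index k) := by
    intro k
    have h3 := (partComposition lam).sizeUpTo_index_le k
    have h4 := (partComposition lam).lt_sizeUpTo_index_succ k
    rw [Fin.val_succ, Composition.sizeUpTo_succ', h1] at h4
    omega
  exact Fin.ext (by rw [h2 i, h2 j, hij])

/-- The regular representation is a direct summand of the permutation representation on the
cosets of a trivial subgroup. -/
theorem exists_retract_permRep {G : Type} [Group G] [Finite G] (H : Subgroup G)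
    (hH : ∀ g ∈ H, g = 1) :
    ∃ (a : regRep K G ⟶ permRep K G (G ⧸ H)) (b : permRep K G (G ⧸ H) ⟶ regRep K G),
      a ≫ b = 𝟙 _ := by
  let v : permRep K G (G ⧸ H) :=
    (MonoidAlgebra.single ((1 : G) : G ⧸ H) (1 : K) : MonoidAlgebra K (G ⧸ H))
  let ξ : permRep K G (G ⧸ H) →ₗ[K] K := Finsupp.lapply ((1 : G) : G ⧸ H) ∘ₗ
    (MonoidAlgebra.coeffLinearEquiv K (S := K) (M := G ⧸ H)).toLinearMap
  refine ⟨fromReg _ v, toReg _ ξ, fromReg_comp_toReg fun g => ?_⟩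
  have h1 : (permRep K G (G ⧸ H)).ρ g v =
      (MonoidAlgebra.single (g : G ⧸ H) (1 : K) : MonoidAlgebra K (G ⧸ H)) := by
    refine (Representation.ofMulAction_single g _ (1 : K)).trans ?_
    rw [MulAction.Quotient.smul_coe, smul_eq_mul, mul_one]
  rw [h1]
  change (MonoidAlgebra.single (g : G ⧸ H) (1 : K)).coeff ((1 : G) : G ⧸ H) = _
  rw [MonoidAlgebra.coeff_single]
  by_cases hg : g = 1
  · rw [hg, Finsupp.single_eq_same, coeffOne_regElt_one]
  · rw [coeffOne_regElt_ne hg, Finsupp.single_eq_of_ne]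
    intro h
    have := hH _ (QuotientGroup.eq.1 h)
    rw [inv_one, one_mul] at this
    exact hg this

/-- The partition `(1, …, 1)` has trivial Young subgroup, so `K[𝔖ₙ]` is a retract of its permutation
module; the identity of `f(K[𝔖ₙ])` then factors through zero. -/
theorem isC0_of_isCY {f : CCat K (SymGrp n)} (hf : isCY K n f) : isC0 K (SymGrp n) f := by
  let lam : n.Partition :=
    ⟨Multiset.replicate n 1, fun {i} hi => by rw [Multiset.eq_of_mem_replicate hi]; exact one_pos,
      by rw [Multiset.sum_replicate, smul_eq_mul, mul_one]⟩
  have hbot : ∀ σ ∈ youngSubgroup lam, σ = 1 := fun σ hσ => Equiv.ext fun i =>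
    partComposition_index_injective lam (fun _ => Multiset.eq_of_mem_replicate) (hσ i)
  obtain ⟨a, b, hab⟩ := exists_retract_permRep (K := K) (youngSubgroup lam) hbot
  rw [isC0, IsZero.iff_id_eq_zero]
  refine Action.hom_ext _ _ ?_
  change 𝟙 (f.obj.obj.obj (regRep K (SymGrp n))) = 0
  rw [← CategoryTheory.Functor.map_id, ← hab, Functor.map_comp,
    (hf lam).eq_of_tgt (f.obj.obj.map a) 0, zero_comp]

end Middle

/-! ### The right diagram: `j_! ∘ c_! = t_!` -/

section Duality

variable {K : Type u} [Field K] {G : Type} [Group G]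

/-- The bilinear form of a morphism `M ⟶ N^∨`. -/
def formOf {M N : FDRep K G} (a : M ⟶ (dualRep K G).obj (op N)) : M →ₗ[K] N →ₗ[K] K := linOf a

theorem formOf_rho {M N : FDRep K G} (a : M ⟶ (dualRep K G).obj (op N)) (g : G) (m : M) (x : N) :
    formOf a (M.ρ g m) (N.ρ g x) = formOf a m x := by
  have h : formOf a (M.ρ g m) = formOf a m ∘ₗ N.ρ g⁻¹ := linOf_comm a g m
  rw [h, LinearMap.comp_apply, ← Module.End.mul_apply, ← map_mul, inv_mul_cancel, map_one,
    Module.End.one_apply]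

theorem formOf_comp {L M N : FDRep K G} (b : L ⟶ M) (a : M ⟶ (dualRep K G).obj (op N)) (m : L)
    (x : N) : formOf (b ≫ a) m x = formOf a (linOf b m) x := rfl

theorem formOf_comp_dual {M N N' : FDRep K G} (a : M ⟶ (dualRep K G).obj (op N')) (b : N ⟶ N')
    (m : M) (x : N) : formOf (a ≫ (dualRep K G).map b.op) m x = formOf a m (linOf b x) := rfl

/-- The pairing of `𝐭_M(N)` with `Hom_G(M, N^∨)`. -/
def tPairing (M N : FDRep K G) :
    ((tFun K G).obj M).obj.obj N →ₗ[K] (M ⟶ (dualRep K G).obj (op N)) →ₗ[K] K :=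
  LinearMap.flip
    { toFun := fun a => tLift (formOf a) (formOf_rho a)
      map_add' := fun _ _ => tMk_ext fun _ _ => rfl
      map_smul' := fun _ _ => tMk_ext fun _ _ => rfl }

/-- A linear form on `(M ⊗ N)_G` is an invariant bilinear form on `M × N`, that is, a morphism `M →
N^∨`. In finite dimensions it is enough that the pairing is nondegenerate on both sides. -/
instance (M N : FDRep K G) : (tPairing M N).IsPerfPair := by
  refine LinearMap.IsPerfPair.of_injective ?_ ?_
  · rw [← LinearMap.ker_eq_bot, LinearMap.ker_eq_bot']
    intro z hz
    refine (Module.forall_dual_apply_eq_zero_iff K z).1 fun ξ => ?_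
    let a : M ⟶ (dualRep K G).obj (op N) :=
      homOfLin (N := (dualRep K G).obj (op N)) ((tMk M N).compr₂ ξ) fun g m =>
        LinearMap.ext fun x => congrArg ξ (tMk_rho_left M N g m x)
    have h : (tPairing M N).flip a = ξ := tMk_ext fun m x => rfl
    rw [← h, LinearMap.flip_apply, hz, LinearMap.zero_apply]
  · rw [← LinearMap.ker_eq_bot, LinearMap.ker_eq_bot']
    intro a ha
    refine fdRep_hom_ext fun m => LinearMap.ext fun x => ?_
    exact LinearMap.congr_fun ha (tMk M N m x)

variable {n : ℕ}

/-- `c_!` is fully faithful. -/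
def cShriekEquiv (M L : FDRep K (SymGrp n)) :
    (M ⟶ L) ≃ₗ[K] ((jUpA K n).obj ((tFun K _).obj M) ⟶ (jUpA K n).obj ((tFun K _).obj L)) where
  toFun a := (jUpA K n).map ((tFun K _).map a)
  map_add' a b := by rw [Functor.map_add, Functor.map_add]
  map_smul' r a := by rw [Functor.map_smul, Functor.map_smul, RingHom.id_apply]
  invFun := cShriekPreimage
  left_inv := cShriekPreimage_map
  right_inv := cShriek_map_preimage

theorem cShriekPreimage_comp_map {L M N : FDRep K (SymGrp n)}
    (φ : (jUpA K n).obj ((tFun K _).obj L) ⟶ (jUpA K n).obj ((tFun K _).obj M)) (b : M ⟶ N) :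
    cShriekPreimage (φ ≫ (jUpA K n).map ((tFun K _).map b)) = cShriekPreimage φ ≫ b := by
  refine (cShriekEquiv L N).injective ?_
  change (jUpA K n).map ((tFun K _).map _) = (jUpA K n).map ((tFun K _).map _)
  rw [cShriek_map_preimage, Functor.map_comp, Functor.map_comp, cShriek_map_preimage]

theorem cShriekPreimage_map_comp {L M N : FDRep K (SymGrp n)} (b : L ⟶ M)
    (φ : (jUpA K n).obj ((tFun K _).obj M) ⟶ (jUpA K n).obj ((tFun K _).obj N)) :
    cShriekPreimage ((jUpA K n).map ((tFun K _).map b) ≫ φ) = b ≫ cShriekPreimage φ := by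
  refine (cShriekEquiv L N).injective ?_
  change (jUpA K n).map ((tFun K _).map _) = (jUpA K n).map ((tFun K _).map _)
  rw [cShriek_map_preimage, Functor.map_comp, Functor.map_comp, cShriek_map_preimage]

/-- The morphisms `c_!(M) ⟶ c_!(N^∨)`. -/
abbrev CShriekHom (M N : FDRep K (SymGrp n)) :=
  (jUpA K n).obj ((tFun K _).obj M) ⟶ (jUpA K n).obj ((tFun K _).obj ((dualRep K _).obj (op N)))

/-- `𝐭_M(N) = Hom(c_!(M), c_!(N^∨))^∨`. -/
def tFunEquiv (M N : FDRep K (SymGrp n)) :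
    ((tFun K _).obj M).obj.obj N ≃ₗ[K] Module.Dual K (Shrink.{u} (CShriekHom M N)) :=
  (tPairing M N).toPerfPair.trans
    ((Shrink.linearEquiv K _).trans
      (cShriekEquiv M ((dualRep K _).obj (op N))).symm).dualMap

/-- Naturality in `N`. On a class `m ⊗ x` both sides evaluate the bilinear form of the preimage of
`φ` under `c_!`. -/
theorem tFunEquiv_mapLin {M N N' : FDRep K (SymGrp n)} (a : N ⟶ N')
    (z : ((tFun K _).obj M).obj.obj N) :
    tFunEquiv M N' (mapLin ((tFun K _).obj M) a z) = tFunEquiv M N z ∘ₗ shrinkMap K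
      (Linear.rightComp K ((jUpA K n).obj ((tFun K _).obj M))
        ((jUpA K n).map ((tFun K _).map ((dualRep K _).map a.op)))) := by
  refine LinearMap.congr_fun (f := (tFunEquiv M N').toLinearMap ∘ₗ mapLin ((tFun K _).obj M) a)
    (g := (LinearMap.lcomp K K _) ∘ₗ (tFunEquiv M N).toLinearMap)
    (tMk_ext fun m x => LinearMap.ext fun φ => ?_) z
  change formOf (cShriekPreimage (Shrink.linearEquiv K _ φ)) m (linOf a x) =
    formOf (cShriekPreimage (Shrink.linearEquiv K _ ((Shrink.linearEquiv K _).symm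
      (Shrink.linearEquiv K _ φ ≫ _)))) m x
  rw [LinearEquiv.apply_symm_apply, cShriekPreimage_comp_map, formOf_comp_dual]

theorem tFunEquiv_map {M M' N : FDRep K (SymGrp n)} (b : M ⟶ M')
    (z : ((tFun K _).obj M).obj.obj N) :
    tFunEquiv M' N ((((tFun K _).map b).hom.app N).hom.hom z) = tFunEquiv M N z ∘ₗ shrinkMap K
      (Linear.leftComp K ((jUpA K n).obj ((tFun K _).obj ((dualRep K _).obj (op N))))
        ((jUpA K n).map ((tFun K _).map b))) := by
  refine LinearMap.congr_fun
    (f := (tFunEquiv M' N).toLinearMap ∘ₗ (((tFun K _).map b).hom.app N).hom.hom)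
    (g := (LinearMap.lcomp K K _) ∘ₗ (tFunEquiv M N).toLinearMap)
    (tMk_ext fun m x => LinearMap.ext fun φ => ?_) z
  change formOf (cShriekPreimage (Shrink.linearEquiv K _ φ)) (linOf b m) x =
    formOf (cShriekPreimage (Shrink.linearEquiv K _ ((Shrink.linearEquiv K _).symm
      (_ ≫ Shrink.linearEquiv K _ φ)))) m x
  rw [LinearEquiv.apply_symm_apply, cShriekPreimage_map_comp, formOf_comp]

/-- `j_! ∘ c_! = t_!`, as functors to `𝒜ₙ`. -/
def tFunIso : tFun K (SymGrp n) ≅ cShriek K n ⋙ jShriekA K n :=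
  NatIso.ofComponents
    (fun M => (isLinearFunctor K _).isoMk (NatIso.ofComponents
      (fun N => (tFunEquiv M N).toFGModuleCatIso)
      fun a => FGModuleCat.hom_ext (LinearMap.ext fun z => tFunEquiv_mapLin a z)))
    fun b => ObjectProperty.hom_ext _ (NatTrans.ext (funext fun _ =>
      FGModuleCat.hom_ext (LinearMap.ext fun z => tFunEquiv_map b z)))

end Duality

/-! ### Invariants as morphisms from the dual -/

section Invariants

variable {K : Type u} [Field K] {G : Type} [Group G]

/-- `M ⊗ X = Hom(M^∨, X)`. -/
def tensorHomEquiv (M X : FDRep K G) : (M ⊗[K] X) ≃ₗ[K] (Module.Dual K M →ₗ[K] X) :=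
  (TensorProduct.congr (Module.evalEquiv K M) (LinearEquiv.refl K X)).trans
    (dualTensorHomEquiv K (Module.Dual K M) X)

theorem tensorHomEquiv_tmul {M X : FDRep K G} (m : M) (x : X) (η : Module.Dual K M) :
    tensorHomEquiv M X (m ⊗ₜ x) η = η m • x := by
  simp [tensorHomEquiv]

theorem tensorHomEquiv_rho {M X : FDRep K G} (g : G) (z : M ⊗[K] X) (η : Module.Dual K M) :
    tensorHomEquiv M X ((M ⊗ X).ρ g z) η = X.ρ g (tensorHomEquiv M X z (η ∘ₗ M.ρ g)) := by
  induction z using TensorProduct.induction_on with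
  | zero => simp only [map_zero, LinearMap.zero_apply]
  | tmul m x =>
    change tensorHomEquiv M X (M.ρ g m ⊗ₜ X.ρ g x) η = _
    rw [tensorHomEquiv_tmul, tensorHomEquiv_tmul, map_smul]
    rfl
  | add z w hz hw =>
    have h : (M ⊗ X).ρ g (z + w) = (M ⊗ X).ρ g z + (M ⊗ X).ρ g w := map_add _ z w
    rw [h]
    refine (LinearMap.congr_fun (map_add (tensorHomEquiv M X) _ _) η).trans ?_
    rw [LinearMap.add_apply, hz, hw, map_add, LinearMap.add_apply, map_add]

theorem tensorHomEquiv_map {M X M' X' : FDRep K G} (a : M ⟶ M') (b : X ⟶ X') (z : M ⊗[K] X)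
    (η : Module.Dual K M') :
    tensorHomEquiv M' X' (TensorProduct.map (linOf a) (linOf b) z) η =
      linOf b (tensorHomEquiv M X z (η ∘ₗ linOf a)) := by
  induction z using TensorProduct.induction_on with
  | zero => simp only [map_zero, LinearMap.zero_apply]
  | tmul m x =>
    rw [TensorProduct.map_tmul, tensorHomEquiv_tmul, tensorHomEquiv_tmul, map_smul]
    rfl
  | add z w hz hw =>
    rw [map_add, map_add, map_add, LinearMap.add_apply, hz, hw, LinearMap.add_apply, map_add]

/-- Under `M ⊗ X = Hom(M^∨, X)` the diagonal action becomes conjugation, whose fixed points are the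
equivariant maps. -/
theorem mem_invariants_iff {M X : FDRep K G} (z : M ⊗[K] X) :
    z ∈ Representation.invariants (MonoidalCategory.tensorObj M X).ρ ↔
      ∀ (g : G) (η : Module.Dual K M),
        tensorHomEquiv M X z (η ∘ₗ M.ρ g⁻¹) = X.ρ g (tensorHomEquiv M X z η) := by
  have h0 : ∀ (g : G) (η : Module.Dual K M), (η ∘ₗ M.ρ g⁻¹) ∘ₗ M.ρ g = η := by
    intro g η
    rw [LinearMap.comp_assoc, ← Module.End.mul_eq_comp, ← map_mul, inv_mul_cancel, map_one]
    rfl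
  have h0' : ∀ (g : G) (η : Module.Dual K M), (η ∘ₗ M.ρ g) ∘ₗ M.ρ g⁻¹ = η := by
    intro g η
    rw [LinearMap.comp_assoc, ← Module.End.mul_eq_comp, ← map_mul, mul_inv_cancel, map_one]
    rfl
  constructor
  · intro hz g η
    have h2 : (MonoidalCategory.tensorObj M X).ρ g z = z := hz g
    rw [← h2, tensorHomEquiv_rho, h0, h2]
  · intro hz g
    refine (tensorHomEquiv M X).injective (LinearMap.ext fun η => ?_)
    rw [tensorHomEquiv_rho, ← hz, h0']

/-- `(M ⊗ X)^G = Hom_G(M^∨, X)`. -/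
def uFunEquiv (M X : FDRep K G) :
    ((uFun K G).obj M).obj.obj X ≃ₗ[K] ((dualRep K G).obj (op M) ⟶ X) where
  toFun z := homOfLin (M := (dualRep K G).obj (op M)) (tensorHomEquiv M X z.1)
    ((mem_invariants_iff z.1).1 z.2)
  map_add' z w := Action.hom_ext _ _ (FGModuleCat.hom_ext (map_add (tensorHomEquiv M X) z.1 w.1))
  map_smul' r z := Action.hom_ext _ _ (FGModuleCat.hom_ext (map_smul (tensorHomEquiv M X) r z.1))
  invFun a := ⟨(tensorHomEquiv M X).symm (linOf a), (mem_invariants_iff _).2 fun g η => by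
    have h := (tensorHomEquiv M X).apply_symm_apply (linOf a)
    exact (LinearMap.congr_fun h _).trans
      ((linOf_comm a g η).trans (congrArg (X.ρ g) (LinearMap.congr_fun h η).symm))⟩
  left_inv z := Subtype.ext ((tensorHomEquiv M X).symm_apply_apply z.1)
  right_inv a := fdRep_hom_ext fun η =>
    LinearMap.congr_fun ((tensorHomEquiv M X).apply_symm_apply (linOf a)) η

/-- The functors `X ↦ (M ⊗ X)^G` and `𝐡_{M^∨}` agree. -/
def uFunIso : uFun K G ≅ (dualRep K G).rightOp ⋙ hG K G :=
  NatIso.ofComponents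
    (fun M => (isLinearFunctor K _).isoMk (NatIso.ofComponents
      (fun X => (uFunEquiv M X).toFGModuleCatIso)
      fun b => FGModuleCat.hom_ext (LinearMap.ext fun z => fdRep_hom_ext fun η =>
        tensorHomEquiv_map (𝟙 M) b z.1 η)))
    fun a => ObjectProperty.hom_ext _ (NatTrans.ext (funext fun X =>
      FGModuleCat.hom_ext (LinearMap.ext fun z => fdRep_hom_ext fun η =>
        tensorHomEquiv_map a (𝟙 X) z.1 η)))

end Invariants

/-! ### The left diagram: `j_* ∘ c_* = t_*` -/

section HPowIso

variable {K : Type u} [Field K] {n : ℕ}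

/-- `M ↦ j^*(𝐡_M)` is fully faithful. -/
def hPowEquiv (L N : FDRep K (SymGrp n)) :
    (L ⟶ N) ≃ₗ[K] ((jUpA K n).obj ((hG K _).obj (op N)) ⟶
      (jUpA K n).obj ((hG K _).obj (op L))) where
  toFun a := (jUpA K n).map ((hG K _).map a.op)
  map_add' a b := hPow_map_add K n a b
  map_smul' r a := hPow_map_smul K n r a
  invFun := hPreimage
  left_inv := hPreimage_map
  right_inv := hG_map_preimage

/-- `hPowEquiv`, with values in the small model of the space of morphisms. -/
def hGEquiv (L N : FDRep K (SymGrp n)) :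
    (L ⟶ N) ≃ₗ[K] Shrink.{u} ((jUpA K n).obj ((hG K _).obj (op N)) ⟶
      (jUpA K n).obj ((hG K _).obj (op L))) :=
  (hPowEquiv L N).trans (Shrink.linearEquiv K _).symm

theorem hGEquiv_comp {L N N' : FDRep K (SymGrp n)} (a : L ⟶ N) (b : N ⟶ N') :
    hGEquiv (n := n) L N' (a ≫ b) = shrinkMap K
      (Linear.leftComp K ((jUpA K n).obj ((hG K _).obj (op L)))
        ((jUpA K n).map ((hG K _).map b.op))) (hGEquiv L N a) := by
  refine congrArg (Shrink.linearEquiv K _).symm ?_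
  change (jUpA K n).map ((hG K _).map (a ≫ b).op) = (jUpA K n).map ((hG K _).map b.op) ≫
    Shrink.linearEquiv K _ ((Shrink.linearEquiv K _).symm ((jUpA K n).map ((hG K _).map a.op)))
  rw [LinearEquiv.apply_symm_apply, op_comp, Functor.map_comp, Functor.map_comp]

theorem hGEquiv_comp' {L L' N : FDRep K (SymGrp n)} (c : L' ⟶ L) (a : L ⟶ N) :
    hGEquiv (n := n) L' N (c ≫ a) = shrinkMap K
      (Linear.rightComp K ((jUpA K n).obj ((hG K _).obj (op N)))
        ((jUpA K n).map ((hG K _).map c.op))) (hGEquiv L N a) := by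
  refine congrArg (Shrink.linearEquiv K _).symm ?_
  change (jUpA K n).map ((hG K _).map (c ≫ a).op) =
    Shrink.linearEquiv K _ ((Shrink.linearEquiv K _).symm ((jUpA K n).map ((hG K _).map a.op))) ≫
      (jUpA K n).map ((hG K _).map c.op)
  rw [LinearEquiv.apply_symm_apply, op_comp, Functor.map_comp, Functor.map_comp]

/-- `j_*(j^*(𝐡_L)) = 𝐡_L`. -/
def hGIso : hG K (SymGrp n) ≅ hG K (SymGrp n) ⋙ jUpA K n ⋙ jLowA K n :=
  NatIso.ofComponents
    (fun L => (isLinearFunctor K _).isoMk (NatIso.ofComponents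
      (fun N => (hGEquiv L.unop N).toFGModuleCatIso)
      fun b => FGModuleCat.hom_ext (LinearMap.ext fun a => hGEquiv_comp a b)))
    fun c => ObjectProperty.hom_ext _ (NatTrans.ext (funext fun _ =>
      FGModuleCat.hom_ext (LinearMap.ext fun a => hGEquiv_comp' c.unop a)))

/-- `j_* ∘ c_* = t_*`, as functors to `𝒜ₙ`. -/
def cLowIso : cLow K n ⋙ jLowA K n ≅ (dualRep K (SymGrp n)).rightOp ⋙ hG K (SymGrp n) :=
  Functor.associator (uFun K (SymGrp n)) (jUpA K n) (jLowA K n) ≪≫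
    Functor.isoWhiskerRight uFunIso (jUpA K n ⋙ jLowA K n) ≪≫
    Functor.associator (dualRep K (SymGrp n)).rightOp (hG K (SymGrp n)) (jUpA K n ⋙ jLowA K n) ≪≫
    Functor.isoWhiskerLeft (dualRep K (SymGrp n)).rightOp hGIso.symm

end HPowIso

/-! ### Criteria for coherence -/

section Coherence

variable {K : Type u} [Field K] {G : Type} [Group G]

instance : HasFiniteBiproducts (FDRep K G) := HasFiniteBiproducts.of_hasFiniteProducts

/-- A finite presentation of a functor by one generator and one relation. -/
structure IsPresentation (f : ACat K G) {M N : FDRep K G} (x : f.obj.obj M) (m : M ⟶ N) :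
    Prop where
  generates : ∀ {X : FDRep K G} (y : f.obj.obj X), ∃ φ : M ⟶ X, mapLin f φ x = y
  relation : ∀ {X : FDRep K G} (φ : M ⟶ X), mapLin f φ x = 0 ↔ ∃ ψ : N ⟶ X, m ≫ ψ = φ

/-- By Yoneda, `𝐡_M → f` is an element `x` of `f(M)` and `𝐡_N → 𝐡_M` is a morphism `m : M ⟶ N`.
Exactness then describes the morphisms that kill `x`. -/
theorem isCoherent_iff (f : ACat K G) : isCoherent K G f ↔
    ∃ (M N : FDRep K G) (x : f.obj.obj M) (m : M ⟶ N), IsPresentation f x m := by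
  constructor
  · rintro ⟨M, N, a, q, h⟩
    have hq : ∀ {X : FDRep K G} (φ : M ⟶ X), (q.hom.app X).hom.hom φ =
        mapLin f φ ((q.hom.app M).hom.hom (𝟙 M)) := fun {X} φ => by
      have h1 := LinearMap.congr_fun (congrArg (fun β => β.hom.hom) (q.hom.naturality φ)) (𝟙 M)
      refine Eq.trans ?_ h1
      exact congrArg (q.hom.app X).hom.hom (Category.id_comp φ).symm
    have ha : ∀ {X : FDRep K G} (ψ : N ⟶ X), (a.hom.app X).hom.hom ψ =
        (show M ⟶ N from (a.hom.app N).hom.hom (𝟙 N)) ≫ ψ := fun {X} ψ => by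
      have h1 := LinearMap.congr_fun (congrArg (fun β => β.hom.hom) (a.hom.naturality ψ)) (𝟙 N)
      refine Eq.trans ?_ h1
      exact congrArg (a.hom.app X).hom.hom (Category.id_comp ψ).symm
    refine ⟨M, N, (q.hom.app M).hom.hom (𝟙 M), (a.hom.app N).hom.hom (𝟙 N), ?_, ?_⟩
    · intro X y
      obtain ⟨φ, hφ⟩ := (h X).2 y
      exact ⟨φ, (hq φ).symm.trans hφ⟩
    · intro X φ
      rw [← hq φ]
      refine ((h X).1 φ).trans (exists_congr fun ψ => ?_)
      exact Eq.congr (ha ψ) rfl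
  · rintro ⟨M, N, x, m, h⟩
    refine ⟨M, N, (hG K G).map m.op, ObjectProperty.homMk
      { app := fun X => FGModuleCat.ofHom ((mapLinₗ f M X).flip x)
        naturality := fun X Z b => FGModuleCat.hom_ext (LinearMap.ext fun φ =>
          mapLin_comp f φ b x) }, fun X => ⟨fun φ => ?_, fun y => ?_⟩⟩
    · exact h.relation φ
    · exact h.generates y

/-- `f` is coherent if it has a generator and if the annihilator of each of its elements is
finitely generated. -/
theorem isCoherent_of_generator {f : ACat K G} {M : FDRep K G} (x : f.obj.obj M)
    (hx : ∀ {X : FDRep K G} (y : f.obj.obj X), ∃ φ : M ⟶ X, mapLin f φ x = y)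
    (h : ∃ (N : FDRep K G) (m : M ⟶ N), ∀ {X : FDRep K G} (φ : M ⟶ X),
      mapLin f φ x = 0 ↔ ∃ ψ : N ⟶ X, m ≫ ψ = φ) : isCoherent K G f := by
  obtain ⟨N, m, hm⟩ := h
  exact (isCoherent_iff f).2 ⟨M, N, x, m, hx, hm⟩

/-- The annihilator of an element of a coherent functor is finitely generated. -/
theorem exists_annihilator {f : ACat K G} (hf : isCoherent K G f) {M : FDRep K G}
    (x : f.obj.obj M) : ∃ (N : FDRep K G) (m : M ⟶ N), ∀ {X : FDRep K G} (φ : M ⟶ X),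
      mapLin f φ x = 0 ↔ ∃ ψ : N ⟶ X, m ≫ ψ = φ := by
  obtain ⟨M₀, N₀, x₀, m₀, h⟩ := (isCoherent_iff f).1 hf
  obtain ⟨u, rfl⟩ := h.generates x
  -- Since `x` is the image of the generator under `u`, the morphism `φ` kills `x` exactly when `u ≫
  -- φ` factors through `m₀`, which means that `φ` extends to the pushout.
  refine ⟨pushout u m₀, pushout.inl u m₀, fun {X} φ => ?_⟩
  rw [← mapLin_comp, h.relation]
  constructor
  · rintro ⟨ψ, hψ⟩
    exact ⟨pushout.desc φ ψ hψ.symm, pushout.inl_desc _ _ _⟩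
  · rintro ⟨ψ, rfl⟩
    exact ⟨pushout.inr u m₀ ≫ ψ, by rw [← Category.assoc, ← pushout.condition, Category.assoc]⟩

/-- Finitely many conditions to factor through given morphisms are equivalent to one. -/
theorem exists_joint_factorization {κ : Type*} (s : Finset κ) {M : FDRep K G}
    {N : κ → FDRep K G} (m : ∀ k, M ⟶ N k) :
    ∃ (N' : FDRep K G) (m' : M ⟶ N'), ∀ {X : FDRep K G} (φ : M ⟶ X),
      (∀ k ∈ s, ∃ ψ : N k ⟶ X, m k ≫ ψ = φ) ↔ ∃ ψ : N' ⟶ X, m' ≫ ψ = φ := by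
  classical
  induction s using Finset.induction_on with
  | empty => exact ⟨M, 𝟙 M, fun φ => ⟨fun _ => ⟨φ, Category.id_comp φ⟩, fun _ k hk =>
      absurd hk (Finset.notMem_empty k)⟩⟩
  | insert k s _ ih =>
    obtain ⟨N', m', h⟩ := ih
    refine ⟨pushout (m k) m', m k ≫ pushout.inl _ _, fun φ => ?_⟩
    rw [Finset.forall_mem_insert, h]
    constructor
    · rintro ⟨⟨ψ, hψ⟩, ⟨ψ', hψ'⟩⟩
      exact ⟨pushout.desc ψ ψ' (hψ.trans hψ'.symm), by
        rw [Category.assoc, pushout.inl_desc, hψ]⟩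
    · rintro ⟨ψ, rfl⟩
      exact ⟨⟨pushout.inl _ _ ≫ ψ, (Category.assoc _ _ _).symm⟩,
        ⟨pushout.inr _ _ ≫ ψ, by rw [pushout.condition, Category.assoc]⟩⟩

/-- `f` is coherent if it has a presentation with finitely many generators and relations. -/
theorem isCoherent_of_presentation {f : ACat K G} {ι κ : Type} [Fintype ι] [Fintype κ]
    {M N : FDRep K G} (x : ι → f.obj.obj M) (m : ι → κ → (M ⟶ N))
    (gen : ∀ {X : FDRep K G} (y : f.obj.obj X), ∃ φ : ι → (M ⟶ X), ∑ i, mapLin f (φ i) (x i) = y)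
    (rel : ∀ {X : FDRep K G} (φ : ι → (M ⟶ X)), ∑ i, mapLin f (φ i) (x i) = 0 ↔
      ∃ ψ : κ → (N ⟶ X), ∀ i, ∑ k, m i k ≫ ψ k = φ i) : isCoherent K G f := by
  classical
  have key : ∀ {X : FDRep K G} (φ : (⨁ fun _ : ι => M) ⟶ X),
      mapLin f φ (∑ i, mapLin f (biproduct.ι (fun _ : ι => M) i) (x i)) =
        ∑ i, mapLin f (biproduct.ι (fun _ : ι => M) i ≫ φ) (x i) := fun φ => by
    rw [map_sum]
    exact Finset.sum_congr rfl fun i _ => (mapLin_comp f _ _ _).symm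
  -- The generators are merged into one element over the sum of copies of `M`, and the relations
  -- into one matrix.
  refine isCoherent_of_generator (∑ i, mapLin f (biproduct.ι (fun _ : ι => M) i) (x i))
    (fun {X} y => ?_) ⟨⨁ fun _ : κ => N, biproduct.matrix m, fun {X} φ => ?_⟩
  · obtain ⟨φ, hφ⟩ := gen y
    refine ⟨biproduct.desc φ, ?_⟩
    rw [key, ← hφ]
    exact Finset.sum_congr rfl fun i _ => by rw [biproduct.ι_desc]
  · have hm : ∀ (ψ : (⨁ fun _ : κ => N) ⟶ X) (i : ι),
        biproduct.ι (fun _ : ι => M) i ≫ biproduct.matrix m ≫ ψ =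
          ∑ k, m i k ≫ biproduct.ι (fun _ : κ => N) k ≫ ψ := by
      intro ψ i
      rw [← Category.assoc, biproduct.ι_matrix, biproduct.lift_eq, Preadditive.sum_comp]
      exact Finset.sum_congr rfl fun k _ => Category.assoc _ _ _
    rw [key, rel]
    constructor
    · rintro ⟨ψ, hψ⟩
      refine ⟨biproduct.desc ψ, biproduct.hom_ext' _ _ fun i => ?_⟩
      rw [hm, ← hψ]
      exact Finset.sum_congr rfl fun k _ => by rw [biproduct.ι_desc]
    · rintro ⟨ψ, rfl⟩
      exact ⟨fun k => biproduct.ι (fun _ : κ => N) k ≫ ψ, fun i => (hm ψ i).symm⟩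

/-- Coherence is invariant under isomorphism. -/
theorem isCoherent_of_iso {f g : ACat K G} (e : f ≅ g) (hf : isCoherent K G f) :
    isCoherent K G g := by
  obtain ⟨M, N, a, q, h⟩ := hf
  refine ⟨M, N, a, q ≫ e.hom, fun X => ?_⟩
  have hi : Function.Bijective (e.hom.hom.app X).hom.hom := by
    refine Function.bijective_iff_has_inverse.2 ⟨(e.inv.hom.app X).hom.hom, fun x => ?_, fun x => ?_⟩
    · exact congrArg (fun β => (β.hom.app X).hom.hom x) e.hom_inv_id
    · exact congrArg (fun β => (β.hom.app X).hom.hom x) e.inv_hom_id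
  refine ⟨fun y => ?_, hi.2.comp (h X).2⟩
  refine Iff.trans ?_ ((h X).1 y)
  change (e.hom.hom.app X).hom.hom ((q.hom.app X).hom.hom y) = 0 ↔ _
  exact map_eq_zero_iff _ hi.1

end Coherence

/-! ### The duality between `𝐭_{L^∨}(N)` and `Hom_G(N, L)` -/

section EvalPairing

variable {K : Type u} [Field K] {G : Type} [Group G]

/-- The pairing of `𝐭_{L^∨}(N)` with `Hom_G(N, L)`. -/
def evalPairing (L N : FDRep K G) :
    ((tFun K G).obj ((dualRep K G).obj (op L))).obj.obj N →ₗ[K] (N ⟶ L) →ₗ[K] K :=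
  LinearMap.flip
    { toFun := fun θ => tLift (M := (dualRep K G).obj (op L)) (Module.Dual.transpose (linOf θ))
        fun g (ξ : Module.Dual K L) x => by
          change ξ (L.ρ g⁻¹ (linOf θ (N.ρ g x))) = ξ (linOf θ x)
          rw [linOf_comm, ← Module.End.mul_apply, ← map_mul, inv_mul_cancel, map_one,
            Module.End.one_apply]
      map_add' := fun a b => tMk_ext fun (ξ : Module.Dual K L) x => map_add ξ (linOf a x) _
      map_smul' := fun r a => tMk_ext fun (ξ : Module.Dual K L) x => map_smul ξ r (linOf a x) }

theorem evalPairing_tMk {L N : FDRep K G} (ξ : Module.Dual K L) (x : N) (θ : N ⟶ L) :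
    evalPairing L N (tMk ((dualRep K G).obj (op L)) N ξ x) θ = ξ (linOf θ x) := rfl

theorem evalPairing_mapLin {L N N' : FDRep K G} (a : N ⟶ N')
    (z : ((tFun K G).obj ((dualRep K G).obj (op L))).obj.obj N) (θ : N' ⟶ L) :
    evalPairing L N' (mapLin _ a z) θ = evalPairing L N z (a ≫ θ) :=
  LinearMap.congr_fun (f := (evalPairing L N').flip θ ∘ₗ mapLin _ a)
    (g := (evalPairing L N).flip (a ≫ θ)) (tMk_ext fun _ _ => rfl) z

theorem evalPairing_map {L L' N : FDRep K G} (b : L ⟶ L')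
    (z : ((tFun K G).obj ((dualRep K G).obj (op L'))).obj.obj N) (θ : N ⟶ L) :
    evalPairing L N ((((tFun K G).map ((dualRep K G).map b.op)).hom.app N).hom.hom z) θ =
      evalPairing L' N z (θ ≫ b) :=
  LinearMap.congr_fun (f := (evalPairing L N).flip θ ∘ₗ
      (((tFun K G).map ((dualRep K G).map b.op)).hom.app N).hom.hom)
    (g := (evalPairing L' N).flip (θ ≫ b)) (tMk_ext fun _ _ => rfl) z

/-- A linear form on `𝐭_{L^∨}(N)` is an invariant bilinear form on `L^* × N`. Reflexivity of `L`
turns it into a linear map `N → L`, equivariant because of the invariance. -/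
instance (L N : FDRep K G) : (evalPairing L N).IsPerfPair := by
  refine LinearMap.IsPerfPair.of_injective ?_ ?_
  · rw [← LinearMap.ker_eq_bot, LinearMap.ker_eq_bot']
    intro z hz
    refine (Module.forall_dual_apply_eq_zero_iff K z).1 fun ζ => ?_
    let B : Module.Dual K L →ₗ[K] N →ₗ[K] K := (tMk ((dualRep K G).obj (op L)) N).compr₂ ζ
    let θ₀ : N →ₗ[K] L := (Module.evalEquiv K L).symm.toLinearMap ∘ₗ B.flip
    have h1 : ∀ (ξ : Module.Dual K L) (x : N), ξ (θ₀ x) = B ξ x := fun ξ x =>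
      Module.apply_evalEquiv_symm_apply K L ξ _
    let θ : N ⟶ L := homOfLin θ₀ fun g x => separating (K := K) fun ξ => by
      have h2 : ξ (L.ρ g (θ₀ x)) = _ := h1 (ξ ∘ₗ L.ρ g) x
      have h3 := tMk_rho ((dualRep K G).obj (op L)) N g
        (show Module.Dual K L from ξ ∘ₗ L.ρ g) x
      have h4 : (((dualRep K G).obj (op L)).ρ g (show Module.Dual K L from ξ ∘ₗ L.ρ g) :
          Module.Dual K L) = ξ := by
        change (ξ ∘ₗ L.ρ g) ∘ₗ L.ρ g⁻¹ = ξ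
        rw [LinearMap.comp_assoc, ← Module.End.mul_eq_comp, ← map_mul, mul_inv_cancel, map_one]
        rfl
      rw [h1, h2]
      exact congrArg ζ ((congrArg (fun η => tMk _ N η (N.ρ g x)) h4).symm.trans h3)
    have h : (evalPairing L N).flip θ = ζ :=
      tMk_ext fun ξ x => (evalPairing_tMk ξ x θ).trans (h1 ξ x)
    rw [← h, LinearMap.flip_apply, hz, LinearMap.zero_apply]
  · rw [← LinearMap.ker_eq_bot, LinearMap.ker_eq_bot']
    intro θ hθ
    refine fdRep_hom_ext fun x => separating (K := K) fun ξ => ?_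
    exact (LinearMap.congr_fun hθ (tMk _ N ξ x)).trans (map_zero ξ).symm

end EvalPairing

/-! ### Linear forms on spaces of linear maps -/

section LinearAlgebra

variable {K : Type*} [Field K] {ι A T H : Type*} [Fintype ι] [AddCommGroup A] [Module K A]
  [AddCommGroup T] [Module K T] [AddCommGroup H] [Module K H]

/-- The basis splits `Hom(A, T)` into copies of `T`, and on each copy the perfect pairing represents
a form by an element of `H`. -/
theorem exists_form_eq_sum (p : T →ₗ[K] H →ₗ[K] K) [p.IsPerfPair] (b : Module.Basis ι K A)
    (ζ : (A →ₗ[K] T) →ₗ[K] K) : ∃ φ : ι → H, ∀ h, ζ h = ∑ i, p (h (b i)) (φ i) := by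
  have h1 : ∀ i, ∃ y : H, ∀ t, ζ ((b.coord i).smulRight t) = p t y := fun i => by
    obtain ⟨y, hy⟩ := (LinearMap.IsPerfPair.bijective_right p).2
      (ζ ∘ₗ LinearMap.smulRightₗ (b.coord i))
    exact ⟨y, fun t => (LinearMap.congr_fun hy t).symm⟩
  choose φ hφ using h1
  refine ⟨φ, fun h => ?_⟩
  have h2 : h = ∑ i, (b.coord i).smulRight (h (b i)) := by
    refine b.ext fun j => ?_
    classical
    rw [LinearMap.sum_apply, Finset.sum_eq_single j]
    · simp
    · intro i _ hij
      simp [hij.symm]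
    · exact fun hj => absurd (Finset.mem_univ j) hj
  conv_lhs => rw [h2]
  rw [map_sum]
  exact Finset.sum_congr rfl fun i _ => hφ i _

/-- Testing on rank one maps supported on a single basis vector isolates each coordinate. -/
theorem form_sum_injective (p : T →ₗ[K] H →ₗ[K] K) [p.IsPerfPair] (b : Module.Basis ι K A)
    {φ φ' : ι → H}
    (e : ∀ h : A →ₗ[K] T, ∑ i, p (h (b i)) (φ i) = ∑ i, p (h (b i)) (φ' i)) : φ = φ' := by
  classical
  funext i
  refine (LinearMap.IsPerfPair.bijective_right p).1 (LinearMap.ext fun t => ?_)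
  have h1 : ∀ ψ : ι → H, ∑ j, p ((b.coord i).smulRight t (b j)) (ψ j) = p t (ψ i) := by
    intro ψ
    rw [Finset.sum_eq_single i]
    · simp
    · intro j _ hij
      simp [hij]
    · exact fun hj => absurd (Finset.mem_univ i) hj
  have h2 := e ((b.coord i).smulRight t)
  rwa [h1, h1] at h2

theorem exists_form_pi_eq_sum {κ V : Type*} [Fintype κ] [AddCommGroup V] [Module K V]
    (Ψ : (κ → V) →ₗ[K] K) :
    ∃ ψ : κ → V →ₗ[K] K, ∀ v, Ψ v = ∑ k, ψ k (v k) := by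
  classical
  refine ⟨fun k => Ψ ∘ₗ LinearMap.single K (fun _ => V) k, fun v => ?_⟩
  conv_lhs => rw [← Finset.univ_sum_single v]
  rw [map_sum]
  rfl

end LinearAlgebra

/-! ### Natural transformations as maps commuting with the Schur algebra -/

section Schur

variable {K : Type u} [Field K] {n : ℕ}

/-- The linear map underlying the action of a functor on a morphism. -/
def pMap (F : PCat K n) (X Z : GammaCat K n) : (X ⟶ Z) →ₗ[K] F.obj.obj X →ₗ[K] F.obj.obj Z where
  toFun s := (F.obj.map s).hom.hom
  map_add' s t := by rw [Functor.map_add]; rfl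
  map_smul' r s := by rw [Functor.map_smul]; rfl

/-- The obstruction for `h : F(Kⁿ) → T(Kⁿ)` to commute with the endomorphisms of `Kⁿ`. -/
def commutator (F T : PCat K n) :
    (F.obj.obj stdObj →ₗ[K] T.obj.obj stdObj) →ₗ[K] (stdObj (K := K) (n := n) ⟶ stdObj) →ₗ[K]
      (F.obj.obj stdObj →ₗ[K] T.obj.obj stdObj) :=
  LinearMap.mk₂ K (fun h s => h ∘ₗ pMap F _ _ s - pMap T _ _ s ∘ₗ h)
    (fun h h' s => by rw [LinearMap.add_comp, LinearMap.comp_add]; abel)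
    (fun r h s => by rw [LinearMap.smul_comp, LinearMap.comp_smul, smul_sub])
    (fun h s s' => by
      rw [map_add, map_add, LinearMap.comp_add, LinearMap.add_comp]; abel)
    (fun r h s => by rw [map_smul, map_smul, LinearMap.comp_smul, LinearMap.smul_comp, smul_sub])

/-- The value of a natural transformation at `Kⁿ`. -/
def stdVal (F T : PCat K n) : (F ⟶ T) →ₗ[K] F.obj.obj stdObj →ₗ[K] T.obj.obj stdObj where
  toFun η := (η.hom.app stdObj).hom.hom
  map_add' _ _ := rfl
  map_smul' _ _ := rfl

theorem stdVal_injective (F T : PCat K n) : Function.Injective (stdVal F T) :=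
  fun _ _ h => evalStd_injective F T (FGModuleCat.hom_ext h)

theorem commutator_stdVal {F T : PCat K n} (η : F ⟶ T) : commutator F T (stdVal F T η) = 0 :=
  LinearMap.ext fun s => LinearMap.ext fun x => sub_eq_zero.2
    (LinearMap.congr_fun (congrArg (fun β => β.hom.hom) (η.hom.naturality s)) x)

/-- Writing `𝟙 X = ∑ vᵢ ≫ wᵢ` through `Kⁿ` forces the component at `X` to be `∑ F(vᵢ) ≫ h ≫ T(wᵢ)`.
That these components are natural, and give back `h` at `Kⁿ`, uses only the commutation with
endomorphisms of `Kⁿ`. -/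
theorem exists_stdVal_eq {F T : PCat K n} {h : F.obj.obj stdObj →ₗ[K] T.obj.obj stdObj}
    (hc : commutator F T h = 0) : ∃ η : F ⟶ T, stdVal F T η = h := by
  let h' : F.obj.obj stdObj ⟶ T.obj.obj stdObj := FGModuleCat.ofHom h
  have hc' : ∀ s, F.obj.map s ≫ h' = h' ≫ T.obj.map s := fun s =>
    FGModuleCat.hom_ext (LinearMap.ext fun x => sub_eq_zero.1
      (LinearMap.congr_fun (LinearMap.congr_fun hc s) x))
  choose ι inst v w hid using exists_id_eq_sum (K := K) (n := n)
  refine ⟨ObjectProperty.homMk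
    { app := fun X => ∑ i, F.obj.map (v X i) ≫ h' ≫ T.obj.map (w X i)
      naturality := fun X Z f => ?_ }, ?_⟩
  · have h1 : F.obj.map f ≫ ∑ i, F.obj.map (v Z i) ≫ h' ≫ T.obj.map (w Z i) =
        ∑ j, ∑ i, F.obj.map (v X j) ≫ h' ≫ T.obj.map (w X j ≫ f ≫ v Z i ≫ w Z i) := by
      conv_lhs => rw [← Category.id_comp (F.obj.map f), ← F.obj.map_id, hid X, Functor.map_sum]
      rw [Preadditive.sum_comp, Preadditive.sum_comp]
      refine Finset.sum_congr rfl fun j _ => ?_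
      rw [Preadditive.comp_sum]
      refine Finset.sum_congr rfl fun i _ => ?_
      -- The composite `Kⁿ → X → Z → Kⁿ` is an endomorphism of `Kⁿ`, so it can be moved past `h'`.
      have h2 := hc' (w X j ≫ f ≫ v Z i)
      simp only [Functor.map_comp, Category.assoc] at h2 ⊢
      rw [← reassoc_of% h2]
    rw [h1, Preadditive.sum_comp]
    refine Finset.sum_congr rfl fun j _ => ?_
    rw [← Preadditive.comp_sum, ← Preadditive.comp_sum, ← Functor.map_sum,
      ← Preadditive.comp_sum, ← Preadditive.comp_sum, ← hid Z, Category.comp_id,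
      Functor.map_comp, Category.assoc, Category.assoc]
  · have h1 : ∑ i, F.obj.map (v stdObj i) ≫ h' ≫ T.obj.map (w stdObj i) = h' := by
      have h2 : ∀ i, F.obj.map (v stdObj i) ≫ h' ≫ T.obj.map (w stdObj i) =
          h' ≫ T.obj.map (v stdObj i ≫ w stdObj i) := fun i => by
        rw [← Category.assoc, hc', Category.assoc, Functor.map_comp]
      rw [Finset.sum_congr rfl fun i _ => h2 i, ← Preadditive.comp_sum, ← Functor.map_sum, ← hid,
        CategoryTheory.Functor.map_id, Category.comp_id]
    exact congrArg (fun β => β.hom.hom) h1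

instance (X Z : GammaCat K n) : Module.Finite K (X ⟶ Z) :=
  inferInstanceAs (Module.Finite K (divPow K n (X.V →ₗ[K] Z.V)))

end Schur

/-! ### A finite presentation of `j_!(F)`, and coherence of `𝐭_M` -/

section JShriek

variable {K : Type u} [Field K] {n : ℕ}

/-- The representation `(Kⁿ)^{⊗ n}`. -/
abbrev stdRep (K : Type u) [Field K] (n : ℕ) : FDRep K (SymGrp n) := (iFun K n).obj stdObj

/-- The space `(Kⁿ)^{⊗ n} ⊗_{𝔖ₙ} M^∨`. -/
abbrev stdT (M : FDRep K (SymGrp n)) : FGModuleCat.{u} K :=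
  ((tFun K _).obj ((dualRep K _).obj (op M))).obj.obj (stdRep K n)

/-- The morphisms `F ⟶ (-)^{⊗ n} ⊗_{𝔖ₙ} M^∨`. -/
abbrev DualHom (F : PCat K n) (M : FDRep K (SymGrp n)) :=
  F ⟶ (jUpA K n).obj ((tFun K _).obj ((dualRep K _).obj (op M)))

/-- The value at `Kⁿ` of a morphism `F ⟶ (-)^{⊗ n} ⊗_{𝔖ₙ} M^∨`. -/
def tVal (F : PCat K n) (M : FDRep K (SymGrp n)) :
    DualHom F M →ₗ[K] F.obj.obj stdObj →ₗ[K] stdT M :=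
  stdVal F _

/-- The commutator of a linear map `F(Kⁿ) → (Kⁿ)^{⊗ n} ⊗_{𝔖ₙ} M^∨` with the endomorphisms of
`Kⁿ`. -/
def tCommutator (F : PCat K n) (M : FDRep K (SymGrp n)) :
    (F.obj.obj stdObj →ₗ[K] stdT M) →ₗ[K] (stdObj (K := K) (n := n) ⟶ stdObj) →ₗ[K]
      (F.obj.obj stdObj →ₗ[K] stdT M) :=
  commutator F ((jUpA K n).obj ((tFun K _).obj ((dualRep K _).obj (op M))))

theorem tVal_injective (F : PCat K n) (M : FDRep K (SymGrp n)) :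
    Function.Injective (tVal F M) := stdVal_injective _ _

theorem tCommutator_tVal {F : PCat K n} {M : FDRep K (SymGrp n)} (η : DualHom F M) :
    tCommutator F M (tVal F M η) = 0 := commutator_stdVal η

theorem exists_tVal_eq {F : PCat K n} {M : FDRep K (SymGrp n)}
    {h : F.obj.obj stdObj →ₗ[K] stdT M} (hc : tCommutator F M h = 0) :
    ∃ η : DualHom F M, tVal F M η = h := exists_stdVal_eq hc

theorem tCommutator_apply {F : PCat K n} {M : FDRep K (SymGrp n)}
    (h : F.obj.obj stdObj →ₗ[K] stdT M) (s : stdObj (K := K) (n := n) ⟶ stdObj)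
    (x : F.obj.obj stdObj) : tCommutator F M h s x = h (pMap F _ _ s x) -
      mapLin ((tFun K _).obj ((dualRep K _).obj (op M))) ((iFun K n).map s) (h x) := rfl

theorem tVal_comp_map {F : PCat K n} {M N : FDRep K (SymGrp n)} (η : DualHom F N) (b : M ⟶ N)
    (a : F.obj.obj stdObj) :
    tVal F M (η ≫ (jUpA K n).map ((tFun K _).map ((dualRep K _).map b.op))) a =
      (((tFun K _).map ((dualRep K _).map b.op)).hom.app (stdRep K n)).hom.hom
        (tVal F N η a) := rfl

/-- The element of `j_!(F)(M)` given by an element of `F(Kⁿ)` and a morphism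
`(Kⁿ)^{⊗ n} ⟶ M`. -/
def jShriekElt (F : PCat K n) (a : F.obj.obj stdObj) {M : FDRep K (SymGrp n)}
    (θ : stdRep K n ⟶ M) : Module.Dual K (Shrink.{u} (DualHom F M)) :=
  ((evalPairing M (stdRep K n)).flip θ) ∘ₗ (LinearMap.applyₗ a) ∘ₗ (tVal F M) ∘ₗ
    (Shrink.linearEquiv K _).toLinearMap

theorem jShriekElt_shrink (F : PCat K n) (a : F.obj.obj stdObj) {M : FDRep K (SymGrp n)}
    (θ : stdRep K n ⟶ M) (η : DualHom F M) :
    jShriekElt F a θ ((Shrink.linearEquiv K _).symm η) =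
      evalPairing M (stdRep K n) (tVal F M η a) θ := by
  change evalPairing M (stdRep K n) (tVal F M (Shrink.linearEquiv K _
    ((Shrink.linearEquiv K _).symm η)) a) θ = _
  rw [LinearEquiv.apply_symm_apply]

theorem dualHom_ext {F : PCat K n} {M : FDRep K (SymGrp n)}
    {y y' : Module.Dual K (Shrink.{u} (DualHom F M))}
    (h : ∀ η : DualHom F M,
      y ((Shrink.linearEquiv K _).symm η) = y' ((Shrink.linearEquiv K _).symm η)) : y = y' := by
  refine LinearMap.ext fun η => ?_
  rw [← (Shrink.linearEquiv K (DualHom F M)).symm_apply_apply η]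
  exact h _

theorem sum_jShriekElt_shrink {F : PCat K n} {ι : Type} [Fintype ι] (a : ι → F.obj.obj stdObj)
    {M : FDRep K (SymGrp n)} (φ : ι → (stdRep K n ⟶ M)) (η : DualHom F M) :
    (∑ i, jShriekElt F (a i) (φ i)) ((Shrink.linearEquiv K _).symm η) =
      ∑ i, evalPairing M (stdRep K n) (tVal F M η (a i)) (φ i) :=
  (LinearMap.sum_apply _ _ _).trans
    (Finset.sum_congr rfl fun i _ => jShriekElt_shrink F (a i) (φ i) η)

theorem mapLin_jShriekElt (F : PCat K n) (a : F.obj.obj stdObj) {M N : FDRep K (SymGrp n)}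
    (θ : stdRep K n ⟶ M) (b : M ⟶ N) :
    mapLin ((jShriekA K n).obj F) b (jShriekElt F a θ) = jShriekElt F a (θ ≫ b) := by
  refine dualHom_ext (F := F) (M := N) fun η => ?_
  rw [jShriekElt_shrink, ← evalPairing_map, ← tVal_comp_map, ← jShriekElt_shrink]
  change jShriekElt F a θ ((Shrink.linearEquiv K _).symm (Shrink.linearEquiv K _
    ((Shrink.linearEquiv K _).symm η) ≫ _)) = _
  rw [LinearEquiv.apply_symm_apply]
  rfl

/-- The relations between the generators of `j_!(F)`. -/
def jShriekRel (F : PCat K n) {ι κ : Type} [DecidableEq ι]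
    (b : Module.Basis ι K (F.obj.obj stdObj))
    (c : Module.Basis κ K (stdObj (K := K) (n := n) ⟶ stdObj)) (i : ι) (k : κ × ι) :
    stdRep K n ⟶ stdRep K n :=
  b.repr (pMap F _ _ (c k.1) (b k.2)) i • 𝟙 _ - if i = k.2 then (iFun K n).map (c k.1) else 0

/-- Under `evalPairing`, the relation matrix is the transpose of the commutator map; this is what
dictates its entries. -/
theorem sum_evalPairing_jShriekRel (F : PCat K n) {ι κ : Type} [DecidableEq ι] [Fintype ι]
    [Fintype κ] (b : Module.Basis ι K (F.obj.obj stdObj))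
    (c : Module.Basis κ K (stdObj (K := K) (n := n) ⟶ stdObj)) {M : FDRep K (SymGrp n)}
    (h : F.obj.obj stdObj →ₗ[K] stdT M) (ψ : κ × ι → (stdRep K n ⟶ M)) :
    ∑ i, evalPairing M (stdRep K n) (h (b i)) (∑ k, jShriekRel F b c i k ≫ ψ k) =
      ∑ k : κ × ι, evalPairing M (stdRep K n)
        (tCommutator F M h (c k.1) (b k.2)) (ψ k) := by
  simp_rw [map_sum]
  rw [Finset.sum_comm]
  refine Finset.sum_congr rfl fun k _ => ?_
  have h1 : h (pMap F _ _ (c k.1) (b k.2)) =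
      ∑ i, b.repr (pMap F _ _ (c k.1) (b k.2)) i • h (b i) := by
    conv_lhs => rw [← b.sum_repr (pMap F _ _ (c k.1) (b k.2))]
    rw [map_sum]
    exact Finset.sum_congr rfl fun i _ => map_smul h _ _
  have h2 : ∀ i, evalPairing M (stdRep K n) (h (b i)) (jShriekRel F b c i k ≫ ψ k) =
      b.repr (pMap F _ _ (c k.1) (b k.2)) i • evalPairing M (stdRep K n) (h (b i)) (ψ k) -
        if i = k.2 then
          evalPairing M (stdRep K n) (h (b i)) ((iFun K n).map (c k.1) ≫ ψ k) else 0 := by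
    intro i
    rw [jShriekRel, Preadditive.sub_comp, map_sub, Linear.smul_comp, map_smul, Category.id_comp]
    split_ifs
    · rfl
    · rw [zero_comp, map_zero]
  rw [tCommutator_apply, map_sub, LinearMap.sub_apply, evalPairing_mapLin, h1, map_sum, LinearMap.sum_apply,
    Finset.sum_congr rfl fun i _ => h2 i, Finset.sum_sub_distrib,
    Finset.sum_ite_eq' Finset.univ k.2, if_pos (Finset.mem_univ _)]
  congr 1
  exact Finset.sum_congr rfl fun i _ => by rw [map_smul, LinearMap.smul_apply]

/-- Natural transformations embed in the space of linear maps at `Kⁿ`, so a form on them extends to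
that whole space, where `exists_form_eq_sum` describes it. -/
theorem exists_sum_jShriekElt_eq {F : PCat K n} {ι : Type} [Fintype ι]
    (b : Module.Basis ι K (F.obj.obj stdObj)) {M : FDRep K (SymGrp n)}
    (y : Module.Dual K (Shrink.{u} (DualHom F M))) :
    ∃ φ : ι → (stdRep K n ⟶ M), ∑ i, jShriekElt F (b i) (φ i) = y := by
  obtain ⟨r, hr⟩ := LinearMap.exists_leftInverse_of_injective (tVal F M)
    (LinearMap.ker_eq_bot.2 (tVal_injective F M))
  obtain ⟨φ, hφ⟩ := exists_form_eq_sum (evalPairing M (stdRep K n)) b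
    (y ∘ₗ (Shrink.linearEquiv K _).symm.toLinearMap ∘ₗ r)
  refine ⟨φ, dualHom_ext fun η => ?_⟩
  rw [sum_jShriekElt_shrink, ← hφ]
  change y ((Shrink.linearEquiv K _).symm ((r ∘ₗ tVal F M) η)) = _
  rw [hr, LinearMap.id_apply]

/-- The natural transformations are the kernel of the commutator map, and the forms vanishing on the
kernel of a linear map are those that factor through it. A form that factors through the commutator
is, by transposition, a combination of the relations. -/
theorem sum_jShriekElt_eq_zero_iff {F : PCat K n} {ι κ : Type} [DecidableEq ι] [Fintype ι]
    [Fintype κ] (b : Module.Basis ι K (F.obj.obj stdObj))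
    (c : Module.Basis κ K (stdObj (K := K) (n := n) ⟶ stdObj)) {M : FDRep K (SymGrp n)}
    (φ : ι → (stdRep K n ⟶ M)) : ∑ i, jShriekElt F (b i) (φ i) = 0 ↔
      ∃ ψ : κ × ι → (stdRep K n ⟶ M), ∀ i, ∑ k, jShriekRel F b c i k ≫ ψ k = φ i := by
  constructor
  · intro h0
    let C : (F.obj.obj stdObj →ₗ[K] stdT M) →ₗ[K] (κ → (F.obj.obj stdObj →ₗ[K] stdT M)) :=
      LinearMap.pi fun k => (tCommutator F M).flip (c k)
    let Z : (F.obj.obj stdObj →ₗ[K] stdT M) →ₗ[K] K :=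
      ∑ i, (evalPairing M (stdRep K n)).flip (φ i) ∘ₗ LinearMap.applyₗ (b i)
    have hZ : ∀ h, Z h = ∑ i, evalPairing M (stdRep K n) (h (b i)) (φ i) := fun h =>
      LinearMap.sum_apply _ _ _
    have hZC : Z ∈ (LinearMap.ker C).dualAnnihilator := by
      rw [Submodule.mem_dualAnnihilator]
      intro h hh
      obtain ⟨η, rfl⟩ := exists_tVal_eq (c.ext fun k => congrFun hh k : tCommutator F M h = 0)
      rw [hZ, ← sum_jShriekElt_shrink, h0, LinearMap.zero_apply]
    rw [← LinearMap.range_dualMap_eq_dualAnnihilator_ker] at hZC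
    obtain ⟨Ψ, hΨ⟩ := hZC
    obtain ⟨Ψ', hΨ'⟩ := exists_form_pi_eq_sum Ψ
    choose ψ hψ using fun k => exists_form_eq_sum (evalPairing M (stdRep K n)) b (Ψ' k)
    -- Equality of the coefficient families is tested as equality of the forms that they define on
    -- all linear maps `h`.
    refine ⟨fun k => ψ k.1 k.2, fun i => congrFun (form_sum_injective
      (evalPairing M (stdRep K n)) b (φ := fun i => ∑ k, jShriekRel F b c i k ≫ ψ k.1 k.2)
      (φ' := φ) fun h => ?_) i⟩
    have hC : ∀ k, C h k = tCommutator F M h (c k) := fun k => rfl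
    rw [sum_evalPairing_jShriekRel, ← hZ, ← hΨ, LinearMap.dualMap_apply, hΨ',
      Fintype.sum_prod_type]
    refine Finset.sum_congr rfl fun k _ => ?_
    rw [hC, hψ]
  · rintro ⟨ψ, hψ⟩
    refine dualHom_ext fun η => ?_
    rw [sum_jShriekElt_shrink, ← funext hψ, sum_evalPairing_jShriekRel, tCommutator_tVal,
      LinearMap.zero_apply]
    refine Finset.sum_eq_zero fun k _ => ?_
    rw [LinearMap.zero_apply, LinearMap.zero_apply, map_zero, LinearMap.zero_apply]

/-- `j_!` takes its values in coherent functors. -/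
theorem isCoherent_jShriekA (F : PCat K n) : isCoherent K (SymGrp n) ((jShriekA K n).obj F) := by
  classical
  let b := Module.finBasis K (F.obj.obj stdObj)
  let c := Module.finBasis K (stdObj (K := K) (n := n) ⟶ stdObj)
  have hsum : ∀ {M : FDRep K (SymGrp n)} (φ : Fin _ → (stdRep K n ⟶ M)),
      ∑ i, mapLin ((jShriekA K n).obj F) (φ i) (jShriekElt F (b i) (𝟙 _)) =
        ∑ i, jShriekElt F (b i) (φ i) := fun φ =>
    Finset.sum_congr rfl fun i _ => by rw [mapLin_jShriekElt, Category.id_comp]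
  refine isCoherent_of_presentation (f := (jShriekA K n).obj F)
    (fun i => jShriekElt F (b i) (𝟙 _)) (jShriekRel F b c) (fun y => ?_) fun φ => ?_
  · obtain ⟨φ, hφ⟩ := exists_sum_jShriekElt_eq b y
    exact ⟨φ, (hsum φ).trans hφ⟩
  · exact (Eq.congr (hsum φ) rfl).trans (sum_jShriekElt_eq_zero_iff b c φ)

/-- `t_!` takes its values in coherent functors. -/
theorem isCoherent_tFun (M : FDRep K (SymGrp n)) : isCoherent K (SymGrp n) ((tFun K _).obj M) :=
  isCoherent_of_iso (tFunIso.app M).symm (isCoherent_jShriekA _)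

end JShriek

/-! ### Coherence of `j_*(F)` -/

section JLow

variable {K : Type u} [Field K] {n : ℕ}

theorem exists_eq_evalPairing {G : Type} [Group G] {M L : FDRep K G} (ζ : (M ⟶ L) →ₗ[K] K) :
    ∃ z, evalPairing L M z = ζ :=
  (LinearMap.IsPerfPair.bijective_left (evalPairing L M)).2 ζ

/-- For a linear form `ζ` on `Hom(M, L)`, the morphisms `φ` with `ζ ∘ φ^* = 0` are those which
factor through a suitable morphism. -/
theorem exists_annihilator_form {M L : FDRep K (SymGrp n)} (ζ : (M ⟶ L) →ₗ[K] K) :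
    ∃ (N : FDRep K (SymGrp n)) (m : M ⟶ N), ∀ {X : FDRep K (SymGrp n)} (φ : M ⟶ X),
      (∀ θ : X ⟶ L, ζ (φ ≫ θ) = 0) ↔ ∃ ψ : N ⟶ X, m ≫ ψ = φ := by
  -- Forms on `Hom(M, L)` are elements of `𝐭_{L^∨}(M)`, so the condition on `φ` says that `φ` kills
  -- an element of a coherent functor.
  obtain ⟨z, rfl⟩ := exists_eq_evalPairing ζ
  obtain ⟨N, m, h⟩ := exists_annihilator (isCoherent_tFun ((dualRep K _).obj (op L))) z
  refine ⟨N, m, fun {X} φ => Iff.trans ?_ (h φ)⟩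
  rw [← map_eq_zero_iff _ (LinearMap.IsPerfPair.bijective_left (evalPairing L X)).1]
  simp_rw [← evalPairing_mapLin]
  exact ⟨fun h => LinearMap.ext h, fun h θ => LinearMap.congr_fun h θ⟩

/-- Coordinates on `A` reduce the condition to finitely many linear forms, and iterated pushouts
combine the resulting factorization conditions into one. -/
theorem exists_annihilator_family {A κ : Type*} [Finite κ] [AddCommGroup A] [Module K A]
    [Module.Finite K A] {M L : FDRep K (SymGrp n)} (Ξ : κ → (M ⟶ L) →ₗ[K] A) :
    ∃ (N : FDRep K (SymGrp n)) (m : M ⟶ N), ∀ {X : FDRep K (SymGrp n)} (φ : M ⟶ X),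
      (∀ k, ∀ θ : X ⟶ L, Ξ k (φ ≫ θ) = 0) ↔ ∃ ψ : N ⟶ X, m ≫ ψ = φ := by
  let _ := Fintype.ofFinite κ
  let b := Module.finBasis K A
  choose N m h using fun k : κ × Fin (Module.finrank K A) =>
    exists_annihilator_form (b.coord k.2 ∘ₗ Ξ k.1)
  obtain ⟨N', m', h'⟩ := exists_joint_factorization Finset.univ m
  refine ⟨N', m', fun {X} φ => Iff.trans ?_ (h' φ)⟩
  simp_rw [← h]
  constructor
  · intro hφ k _ θ
    rw [LinearMap.comp_apply, hφ, map_zero]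
  · intro hφ k θ
    exact b.ext_elem fun i => (hφ (k, i) (Finset.mem_univ _) θ).trans (by rw [map_zero]; rfl)

/-- A universal linear map on `Hom(-, L)`. -/
theorem exists_universal_map (A : Type*) [AddCommGroup A] [Module K A] [Module.Finite K A]
    (L : FDRep K (SymGrp n)) :
    ∃ (M₀ : FDRep K (SymGrp n)) (Ξ₀ : (M₀ ⟶ L) →ₗ[K] A), ∀ {M : FDRep K (SymGrp n)}
      (Ξ : (M ⟶ L) →ₗ[K] A), ∃ φ : M₀ ⟶ M, ∀ θ, Ξ₀ (φ ≫ θ) = Ξ θ := by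
  classical
  obtain ⟨M₁, N₁, z₁, m₁, h₁⟩ :=
    (isCoherent_iff _).1 (isCoherent_tFun ((dualRep K _).obj (op L)))
  let b := Module.finBasis K A
  -- `Hom(Hom(-, L), A)` is a sum of `dim A` copies of `𝐭_{L^∨}`, so it is generated by one copy of
  -- the generator `z₁` for each coordinate of `A`.
  let B := ⨁ fun _ : Fin (Module.finrank K A) => M₁
  refine ⟨B, ∑ i, (LinearMap.toSpanSingleton K A (b i)) ∘ₗ evalPairing L M₁ z₁ ∘ₗ
    Linear.leftComp K L (biproduct.ι (fun _ => M₁) i), fun {M} Ξ => ?_⟩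
  have h2 : ∀ i, ∃ φ : M₁ ⟶ M, ∀ θ, evalPairing L M₁ z₁ (φ ≫ θ) = b.coord i (Ξ θ) := by
    intro i
    obtain ⟨z, hz⟩ := exists_eq_evalPairing (b.coord i ∘ₗ Ξ)
    obtain ⟨φ, rfl⟩ := h₁.generates z
    exact ⟨φ, fun θ => by rw [← evalPairing_mapLin, hz]; rfl⟩
  choose φ hφ using h2
  refine ⟨biproduct.desc φ, fun θ => ?_⟩
  rw [LinearMap.sum_apply]
  refine Eq.trans (Finset.sum_congr rfl fun i _ => ?_) (b.sum_repr (Ξ θ))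
  change evalPairing L M₁ z₁ (biproduct.ι (fun _ => M₁) i ≫ biproduct.desc φ ≫ θ) • b i = _
  rw [biproduct.ι_desc_assoc, hφ]
  rfl

/-- The morphisms `j^*(𝐡_M) ⟶ F`. -/
abbrev HHom (F : PCat K n) (M : FDRep K (SymGrp n)) :=
  (jUpA K n).obj ((hG K _).obj (op M)) ⟶ F

/-- The value at `Kⁿ` of an element of `j_*(F)(M)`. -/
def jLowVal (F : PCat K n) (M : FDRep K (SymGrp n)) :
    ((jLowA K n).obj F).obj.obj M →ₗ[K] (M ⟶ stdRep K n) →ₗ[K] F.obj.obj stdObj :=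
  (show Shrink.{u} (HHom F M) →ₗ[K] (M ⟶ stdRep K n) →ₗ[K] F.obj.obj stdObj from
    (stdVal ((jUpA K n).obj ((hG K _).obj (op M))) F) ∘ₗ (Shrink.linearEquiv K _).toLinearMap)

theorem jLowVal_injective (F : PCat K n) (M : FDRep K (SymGrp n)) :
    Function.Injective (jLowVal F M) :=
  (stdVal_injective ((jUpA K n).obj ((hG K _).obj (op M))) F).comp
    (Shrink.linearEquiv K (HHom F M)).injective

theorem jLowVal_mapLin {F : PCat K n} {M N : FDRep K (SymGrp n)} (b : M ⟶ N)
    (x : ((jLowA K n).obj F).obj.obj M) (θ : N ⟶ stdRep K n) :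
    jLowVal F N (mapLin _ b x) θ = jLowVal F M x (b ≫ θ) := by
  change stdVal ((jUpA K n).obj ((hG K _).obj (op N))) F (Shrink.linearEquiv K (HHom F N)
    ((Shrink.linearEquiv K (HHom F N)).symm ((jUpA K n).map ((hG K _).map b.op) ≫
      Shrink.linearEquiv K (HHom F M) x))) θ = _
  rw [LinearEquiv.apply_symm_apply]
  rfl

theorem jLowVal_commute {F : PCat K n} {M : FDRep K (SymGrp n)}
    (x : ((jLowA K n).obj F).obj.obj M) (s : stdObj (K := K) (n := n) ⟶ stdObj)
    (θ : M ⟶ stdRep K n) :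
    jLowVal F M x (θ ≫ (iFun K n).map s) = pMap F _ _ s (jLowVal F M x θ) :=
  sub_eq_zero.1 (LinearMap.congr_fun (LinearMap.congr_fun
    (commutator_stdVal (Shrink.linearEquiv K (HHom F M) x)) s) θ)

/-- With `jLowVal_injective` and `jLowVal_commute`, this identifies `j_*(F)(M)` with the linear maps
`Hom(M, (Kⁿ)^{⊗ n}) → F(Kⁿ)` that commute with the Schur algebra. -/
theorem exists_jLowVal_eq {F : PCat K n} {M : FDRep K (SymGrp n)}
    (h : (M ⟶ stdRep K n) →ₗ[K] F.obj.obj stdObj)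
    (hc : ∀ (s : stdObj (K := K) (n := n) ⟶ stdObj) (θ : M ⟶ stdRep K n),
      h (θ ≫ (iFun K n).map s) = pMap F _ _ s (h θ)) : ∃ x, jLowVal F M x = h := by
  obtain ⟨η, hη⟩ := exists_stdVal_eq (F := (jUpA K n).obj ((hG K _).obj (op M))) (T := F) (h := h)
    (LinearMap.ext fun s => LinearMap.ext fun θ => sub_eq_zero.2 (hc s θ))
  refine ⟨(Shrink.linearEquiv K (HHom F M)).symm η, ?_⟩
  change stdVal ((jUpA K n).obj ((hG K _).obj (op M))) F (Shrink.linearEquiv K (HHom F M)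
    ((Shrink.linearEquiv K (HHom F M)).symm η)) = h
  rw [LinearEquiv.apply_symm_apply, hη]

/-- `j_*` takes its values in coherent functors. -/
theorem isCoherent_jLowA (F : PCat K n) : isCoherent K (SymGrp n) ((jLowA K n).obj F) := by
  obtain ⟨M₀, Ξ₀, h₀⟩ := exists_universal_map (F.obj.obj stdObj) (stdRep K n)
  let c := Module.finBasis K (stdObj (K := K) (n := n) ⟶ stdObj)
  let D : (stdObj (K := K) (n := n) ⟶ stdObj) →ₗ[K] (M₀ ⟶ stdRep K n) →ₗ[K] F.obj.obj stdObj :=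
    commutator ((jUpA K n).obj ((hG K _).obj (op M₀))) F Ξ₀
  have hD : ∀ (s : stdObj (K := K) (n := n) ⟶ stdObj) (θ : M₀ ⟶ stdRep K n),
      D s θ = Ξ₀ (θ ≫ (iFun K n).map s) - pMap F _ _ s (Ξ₀ θ) := fun _ _ => rfl
  -- The universal map `Ξ₀` need not commute with the Schur algebra. A morphism `φ` factors through
  -- `m` exactly when the map induced from `Ξ₀` along `φ` does commute.
  obtain ⟨N, m, hm⟩ := exists_annihilator_family fun k => D (c k)
  have hall : ∀ {X : FDRep K (SymGrp n)} (φ : M₀ ⟶ X),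
      (∀ s, ∀ θ : X ⟶ stdRep K n, D s (φ ≫ θ) = 0) ↔ ∃ ψ : N ⟶ X, m ≫ ψ = φ := by
    intro X φ
    refine Iff.trans ⟨fun h k θ => h (c k) θ, fun h s θ => ?_⟩ (hm φ)
    exact LinearMap.congr_fun (f := D.flip (φ ≫ θ)) (g := 0) (c.ext fun k => h k θ) s
  -- Since `m` factors through itself, `Ξ₀` induced along `m` commutes and defines an element over
  -- `N`, which will generate `j_*(F)`.
  obtain ⟨x, hx⟩ := exists_jLowVal_eq (F := F) (M := N) (Ξ₀ ∘ₗ Linear.leftComp K _ m)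
    fun s θ => by
      have h1 := (hall m).2 ⟨𝟙 N, Category.comp_id m⟩ s θ
      rw [hD, sub_eq_zero, Category.assoc] at h1
      exact h1
  have hx' : ∀ θ, jLowVal F N x θ = Ξ₀ (m ≫ θ) := fun θ => by rw [hx]; rfl
  refine isCoherent_of_generator x (fun {X} y => ?_) ?_
  -- Every `y` is induced from `Ξ₀` along some `φ`; as the map attached to `y` commutes, `φ` factors
  -- through `m`, so `y` is an image of `x`.
  · obtain ⟨φ, hφ⟩ := h₀ (jLowVal F X y)
    obtain ⟨ψ, rfl⟩ := (hall φ).1 fun s θ => by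
      rw [hD, Category.assoc, hφ, hφ, jLowVal_commute, sub_self]
    refine ⟨ψ, jLowVal_injective F X (LinearMap.ext fun θ => ?_)⟩
    rw [jLowVal_mapLin, hx', ← Category.assoc, hφ]
  -- The relations: `φ` kills `x` exactly when the map `jLowVal F N x` vanishes on all `φ ≫ θ`.
  · obtain ⟨N', m', h'⟩ := exists_annihilator_family fun _ : Unit => jLowVal F N x
    refine ⟨N', m', fun {X} φ => Iff.trans ?_ (h' φ)⟩
    rw [← map_eq_zero_iff _ (jLowVal_injective F X)]
    constructor
    · intro h _ θ
      rw [← jLowVal_mapLin, h, LinearMap.zero_apply]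
    · intro h
      refine LinearMap.ext fun θ => ?_
      rw [jLowVal_mapLin, h (), LinearMap.zero_apply]

end JLow

/-! ### Passage to the coherent subcategory and the main theorem -/

/-- A natural isomorphism lifts to functors with values in a full subcategory. -/
def liftIso {C D : Type*} [Category* C] [Category* D] (P : ObjectProperty D) {F F' : C ⥤ D}
    (e : F ≅ F') (h : ∀ X, P (F.obj X)) (h' : ∀ X, P (F'.obj X)) : P.lift F h ≅ P.lift F' h' :=
  NatIso.ofComponents (fun X => P.isoMk (e.app X)) fun f =>
    ObjectProperty.hom_ext _ (e.hom.naturality f)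

end PolyRec
end

theorem mainTheorem8 {K : Type u} [Field K] (p : ℕ) [Fact p.Prime] [CharP K p]
    (n : ℕ) (hn : 0 < n) :
    -- the functors `t_!`, `j_*` and `j_!` take their values in coherent functors
    ∃ (ht : ∀ M : FDRep K (SymGrp n), isCoherent K (SymGrp n) ((tFun K (SymGrp n)).obj M))
      (hl : ∀ F : PCat K n, isCoherent K (SymGrp n) ((jLowA K n).obj F))
      (hs : ∀ F : PCat K n, isCoherent K (SymGrp n) ((jShriekA K n).obj F)),
      -- left diagram: `j_* ∘ c_* = t_*`
      Nonempty (cLow K n ⋙ (isCoherent K (SymGrp n)).lift (jLowA K n) hl ≅ tLow K (SymGrp n)) ∧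
      -- middle diagram: `c^* ∘ j^* = t^*`
      Nonempty (jUp K n ⋙ cUp K n ≅ tUp K (SymGrp n)) ∧
      -- middle diagram: the inclusion of the kernel categories `𝒞^Y ⊆ 𝒞⁰` over `𝒞`
      (∃ k : (isCY K n).FullSubcategory ⥤ (isC0 K (SymGrp n)).FullSubcategory,
        k ⋙ (isC0 K (SymGrp n)).ι = (isCY K n).ι) ∧
      -- middle diagram: `j^*` restricts to a functor `𝒞⁰ → 𝒫⁰`
      (∃ j₀ : (isC0 K (SymGrp n)).FullSubcategory ⥤ (isP0 K n).FullSubcategory,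
        j₀ ⋙ (isP0 K n).ι = (isC0 K (SymGrp n)).ι ⋙ jUp K n) ∧
      -- right diagram: `j_! ∘ c_! = t_!`
      Nonempty (cShriek K n ⋙ (isCoherent K (SymGrp n)).lift (jShriekA K n) hs ≅
        (isCoherent K (SymGrp n)).lift (tFun K (SymGrp n)) ht) := by
  refine ⟨isCoherent_tFun, isCoherent_jLowA, isCoherent_jShriekA, ⟨?_⟩, ⟨jUpCUpIso⟩, ?_, ?_, ⟨?_⟩⟩
  · exact liftIso _ cLowIso (fun _ => isCoherent_jLowA _) fun _ => isCoherent_h _ _ _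
  · exact ⟨(isC0 K (SymGrp n)).lift (isCY K n).ι fun f => isC0_of_isCY f.property, rfl⟩
  · exact ⟨(isP0 K n).lift ((isC0 K (SymGrp n)).ι ⋙ jUp K n) fun f => isP0_jUp f.property, rfl⟩
  · exact liftIso _ tFunIso.symm (fun _ => isCoherent_jShriekA _) isCoherent_tFun
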